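/- **Theorem (Langevin and O'Hara).** Let $S^n\subset\mathbb R^{n+1}$ be the unit sphere and let $\Delta$ denote the diagonal. For $x\in S^n$ let $p_x\colon S^n\setminus\{x\}\to x^{\perp}$, $p_x(y)=\frac{y-\langle x,y\rangle x}{1-\langle x,y\rangle}$, be the stereographic projection from $x$ onto the $n$-plane through the origin orthogonal to $x$. Identify $x^\perp$ with $T_xS^n$, and $T_xS^n$ with $T_x^*S^n$ by the Euclidean inner product. This gives a smooth bijection $$\varphi\colon S^n\times S^n\setminus\Delta\to T^*S^n,\qquad (x,y)\mapsto \bigl(x,\ \langle p_x(y),\,\cdot\,\rangle\bigr).$$ Let $\omega_{S^n}$ denote both the canonical symplectic form of $T^*S^n$, which is $\sum_i dq_i\wedge dp_i$ in local coordinates $q_i$ of $S^n$ and the fibre coordinates $p_i$ associated with the basis $\{dq_i\}$, and its pull-back by $\varphi$ to $S^n\times S^n\setminus\Delta$. A Möbius transformation of $S^n$ is the action of an element of the Lorentz group $O(n+1,1)$ on the set of lines in the light cone of $\mathbb R^{n+2}_1$, the point $x\in S^n$ being identified with the line spanned by $(1,x)$. 1. For every $n$ and every Möbius transformation $T$ of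 $S^n$ (which is smooth and preserves $S^n\times S^n\setminus\Delta$), $(T\times T)^*\omega_{S^n}=\omega_{S^n}$ on $S^n\times S^n\setminus\Delta$. 2. Let $\omega_{\rm cr}=\frac{dw\wedge dz}{(w-z)^2}$ on $\mathbb C\times\mathbb C\setminus\Delta$, and let $\sigma\colon\mathbb C\to S^2$ be the inverse of a stereographic projection of $S^2$ from one of its points onto the corresponding equatorial plane, identified isometrically with $\mathbb C$. Then $\operatorname{Re}\omega_{\rm cr}=-\tfrac12(\sigma\times\sigma)^*\omega_{S^2}$. 3. Let $2\le k\le\infty$ and let $K\subset S^3$ be a knot of class $C^k$, given by a regular $1$-periodic parametrization $\gamma\colon\mathbb R\to S^3$ of class $C^k$ that is injective modulo $\mathbb Z$. For $x=\gamma(s)\neq y=\gamma(t)$ choose a round $2$-sphere in $S^3$ that is tangent to $K$ at $x$ and at $y$, and identify it with $\mathbb C\cup\{\infty\}$ by a stereographic projection from a point other than $x,y$. Let $\tilde x,\tilde y\in\mathbb C$ be the images of $x,y$, let $a,b\in\mathbb C$ be the images of the tangent vectors $\gamma'(s),\gamma'(t)$, and orient the sphere so that $c(s,t)=\frac{ab}{(\tilde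 x-\tilde y)^2}$ has non-negative imaginary part. Then $c(s,t)$ exists and does not depend on the choices, so that the infinitesimal cross ratio $\Omega_K=\frac{d\tilde x\wedge d\tilde y}{(\tilde x-\tilde y)^2}=c(s,t)\,ds\wedge dt$ is a well-defined complex $2$-form on $K\times K\setminus\Delta$. With the inclusion $\iota\colon K\times K\setminus\Delta\hookrightarrow S^3\times S^3\setminus\Delta$, $$\operatorname{Re}\Omega_K=-\tfrac12\,\iota^*\omega_{S^3}.$$ In particular $\operatorname{Re}\Omega_K$ is exact: there is a $1$-form $\eta$ of class $C^{k-1}$ on $K\times K\setminus\Delta$ with $d\eta=\operatorname{Re}\Omega_K$. -/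

import Mathlib

open Set Metric
open scoped Manifold ContDiff Bundle

namespace MoebiusKnot

noncomputable section

/-! ### Two-forms -/

/-- The wedge product `α ∧ β` of two one-forms on a vector space, with
`(α ∧ β)(v, w) = α(v) β(w) - α(w) β(v)`. -/
def wedge {V A : Type*} [TopologicalSpace V] [AddCommGroup V] [Module ℝ V]
    [NormedCommRing A] [NormedAlgebra ℝ A] (α β : V →L[ℝ] A) : V [⋀^Fin 2]→L[ℝ] A where
  toFun v := α (v 0) * β (v 1) - α (v 1) * β (v 0)
  map_update_add' v i x y := by
    fin_cases i <;> simp [Function.update] <;> ring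
  map_update_smul' v i c x := by
    fin_cases i <;> simp [Function.update, smul_sub]
  map_eq_zero_of_eq' v i j h hij := by
    fin_cases i <;> fin_cases j <;> simp_all
  cont := by fun_prop

/-- The pull-back `f^* α` of a real two-form `α` by a map of manifolds. -/
def pullback {E H M E' H' M' : Type*}
    [NormedAddCommGroup E] [NormedSpace ℝ E] [TopologicalSpace H] (I : ModelWithCorners ℝ E H)
    [TopologicalSpace M] [ChartedSpace H M]
    [NormedAddCommGroup E'] [NormedSpace ℝ E'] [TopologicalSpace H']
    (I' : ModelWithCorners ℝ E' H') [TopologicalSpace M'] [ChartedSpace H' M']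
    (f : M → M') (α : ∀ q : M', TangentSpace I' q [⋀^Fin 2]→L[ℝ] ℝ) (p : M) :
    TangentSpace I p [⋀^Fin 2]→L[ℝ] ℝ :=
  (α (f p)).compContinuousLinearMap (mfderiv I I' f p)

/-! ### The cotangent bundle and its canonical symplectic form -/

/-- `ℝ^m` with its Euclidean norm. -/
abbrev Euc (m : ℕ) : Type := EuclideanSpace ℝ (Fin m)

/-- The total space of the cotangent bundle `T^* M` of an `m`-dimensional manifold `M`. -/
abbrev Cotangent (m : ℕ) (M : Type*) [TopologicalSpace M] [ChartedSpace (Euc m) M]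
    [IsManifold (𝓡 m) ∞ M] : Type _ :=
  Bundle.TotalSpace (Euc m →L[ℝ] ℝ) (fun x : M => TangentSpace (𝓡 m) x →L[ℝ] Bundle.Trivial M ℝ x)

/-- The model with corners of `T^* M`. -/
abbrev cotangentModel (m : ℕ) :
    ModelWithCorners ℝ (Euc m × (Euc m →L[ℝ] ℝ)) (ModelProd (Euc m) (Euc m →L[ℝ] ℝ)) :=
  (𝓡 m).prod 𝓘(ℝ, Euc m →L[ℝ] ℝ)

/-- The `i`-th base coordinate `q_i` on `ℝ^m × (ℝ^m)^*`. -/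
def qCoord {m : ℕ} (i : Fin m) : (Euc m × (Euc m →L[ℝ] ℝ)) →L[ℝ] ℝ :=
  (EuclideanSpace.proj i).comp (ContinuousLinearMap.fst ℝ _ _)

/-- The `i`-th fibre coordinate `p_i` on `ℝ^m × (ℝ^m)^*`, a covector being
`∑ i, p_i dq_i`. -/
def pCoord {m : ℕ} (i : Fin m) : (Euc m × (Euc m →L[ℝ] ℝ)) →L[ℝ] ℝ :=
  (ContinuousLinearMap.apply ℝ ℝ (EuclideanSpace.single i (1 : ℝ))).comp
    (ContinuousLinearMap.snd ℝ _ _)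

/-- The canonical symplectic form `∑ i, dq_i ∧ dp_i` of `T^* M`. At a covector `ξ` it is computed
in the bundle chart `(q_1, …, q_m, p_1, …, p_m)` of `T^* M` that is induced by the preferred chart
`(q_1, …, q_m)` of `M` at the base point of `ξ`. -/
def canonicalSymplecticForm (m : ℕ) (M : Type*) [TopologicalSpace M] [ChartedSpace (Euc m) M]
    [IsManifold (𝓡 m) ∞ M] (ξ : Cotangent m M) :
    TangentSpace (cotangentModel m) ξ [⋀^Fin 2]→L[ℝ] ℝ :=
  (∑ i : Fin m, wedge (qCoord i) (pCoord i)).compContinuousLinearMap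
    (mfderiv (cotangentModel m) 𝓘(ℝ, Euc m × (Euc m →L[ℝ] ℝ))
      (extChartAt (cotangentModel m) ξ) ξ)

/-! ### The identification of `S^n × S^n ∖ Δ` with `T^* S^n` -/

/-- The unit sphere `S^n` of `ℝ^(n+1)`. -/
abbrev Sph (n : ℕ) : Type := sphere (0 : Euc (n + 1)) 1

/-- The model with corners of `S^n × S^n`. -/
abbrev pairModel (n : ℕ) : ModelWithCorners ℝ (Euc n × Euc n) (ModelProd (Euc n) (Euc n)) :=
  (𝓡 n).prod (𝓡 n)

/-- The complement of the diagonal in `X × X`. -/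
def distinctPairs (X : Type*) : Set (X × X) := {p | p.1 ≠ p.2}

/-- The stereographic projection `p_x` of `S^n ∖ {x}` from `x` onto the `n`-plane through the
origin that is orthogonal to `x`. -/
def stereo {n : ℕ} (x y : Sph n) : Euc (n + 1) :=
  (1 - inner ℝ (x : Euc (n + 1)) y)⁻¹ •
    ((y : Euc (n + 1)) - inner ℝ (x : Euc (n + 1)) (y : Euc (n + 1)) • (x : Euc (n + 1)))

/-- The map `φ_x : S^n ∖ {x} → T_x^* S^n`, taking `y` to the covector `v ↦ ⟨p_x(y), v⟩`; here
`T_x S^n` is regarded as a subspace of `ℝ^(n+1)` through the derivative of the inclusion. -/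
def toCovector {n : ℕ} (x y : Sph n) : TangentSpace (𝓡 n) x →L[ℝ] ℝ :=
  (innerSL ℝ (stereo x y)).comp
    (mfderiv (𝓡 n) 𝓘(ℝ, Euc (n + 1)) (fun z : Sph n => (z : Euc (n + 1))) x)

/-- The map `φ : (x, y) ↦ (x, φ_x(y))` from `S^n × S^n ∖ Δ` to `T^* S^n`
(only its values off the diagonal matter). -/
def toCotangent (n : ℕ) (p : Sph n × Sph n) : Cotangent n (Sph n) :=
  ⟨p.1, toCovector p.1 p.2⟩

/-- The two-form `ω_{S^n}` on `S^n × S^n ∖ Δ`: the pull-back by `φ` of the canonical symplectic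
form of `T^* S^n`. -/
def omegaSphere (n : ℕ) (p : Sph n × Sph n) : TangentSpace (pairModel n) p [⋀^Fin 2]→L[ℝ] ℝ :=
  pullback (pairModel n) (cotangentModel n) (toCotangent n) (canonicalSymplecticForm n (Sph n)) p

/-! ### Moebius transformations -/

/-- The matrix `diag(-1, 1, …, 1)` of the Lorentz metric on `ℝ^(n+2)`. -/
def lorentzGram (n : ℕ) : Matrix (Fin (n + 2)) (Fin (n + 2)) ℝ :=
  Matrix.diagonal (Fin.cons (-1) (fun _ => 1))

/-- The lightlike vector `(1, x)` that represents the point `x` of `S^n`. -/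
def lightVec {n : ℕ} (x : Sph n) : Fin (n + 2) → ℝ := Fin.cons 1 (fun i => (x : Euc (n + 1)) i)

/-- `T` is a Moebius transformation of `S^n`: the action of an element of `O(n+1,1)` on the set of
lines in the light cone. -/
def IsMoebius {n : ℕ} (T : Sph n → Sph n) : Prop :=
  ∃ A : Matrix (Fin (n + 2)) (Fin (n + 2)) ℝ,
    A.transpose * lorentzGram n * A = lorentzGram n ∧
    ∀ x : Sph n, ∃ c : ℝ, c ≠ 0 ∧ A.mulVec (lightVec x) = c • lightVec (T x)

/-! ### The complex cross ratio form -/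

/-- The inverse of the stereographic projection, from the pole `q + ρ e₂`, of the two-sphere with
centre `q` and radius `ρ` in the affine three-space `q + span(e₀, e₁, e₂)` onto its equatorial
plane, which is identified with `ℂ` through the orthonormal frame `(e₀, e₁)`
and the scale `ρ`. -/
def invStereo {m : ℕ} (q : Euc m) (ρ : ℝ) (e : Fin 3 → Euc m) (ζ : ℂ) : Euc m :=
  q + (ρ / (‖ζ‖ ^ 2 + 1)) •
    ((2 * ζ.re) • e 0 + (2 * ζ.im) • e 1 + (‖ζ‖ ^ 2 - 1) • e 2)

/-- `σ : ℂ → S^2` is the inverse of a stereographic projection of `S^2`. -/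
def IsInvStereo (σ : ℂ → Sph 2) : Prop :=
  ∃ e : Fin 3 → Euc 3, Orthonormal ℝ e ∧ ∀ ζ, (σ ζ : Euc 3) = invStereo 0 1 e ζ

/-- The complex two-form `ω_cr = dw ∧ dz / (w - z)^2` on `ℂ × ℂ ∖ Δ`. -/
def crossRatioForm (p : ℂ × ℂ) : (ℂ × ℂ) [⋀^Fin 2]→L[ℝ] ℂ :=
  (1 / (p.1 - p.2) ^ 2) • wedge (ContinuousLinearMap.fst ℝ ℂ ℂ) (ContinuousLinearMap.snd ℝ ℂ ℂ)

/-- The real part of a complex-valued two-form. -/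
def rePart {V : Type*} [TopologicalSpace V] [AddCommGroup V] [Module ℝ V]
    (α : V [⋀^Fin 2]→L[ℝ] ℂ) : V [⋀^Fin 2]→L[ℝ] ℝ :=
  Complex.reCLM.compContinuousAlternatingMap α

/-! ### Knots in `S^3` and the infinitesimal cross ratio -/

/-- `γ` is a regular `1`-periodic parametrization, of class `C^k`, of a knot in `S^3`.
The knot `K` is then identified with `ℝ/ℤ`, and `K × K` with `(ℝ/ℤ)²`. -/
structure IsKnot (k : ℕ∞ω) (γ : ℝ → Sph 3) : Prop where
  contDiff : ContDiff ℝ k (fun t => (γ t : Euc 4))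
  immersion : ∀ t, deriv (fun s => (γ s : Euc 4)) t ≠ 0
  eq_iff : ∀ s t, γ s = γ t ↔ ∃ m : ℤ, t = s + m

/-- `c` is the value of `dx̃ dỹ / (x̃ - ỹ)²` on tangent vectors `u`, `v` of a knot at distinct points
`x`, `y` of `S^3`: there is a two-sphere in `S^3` through `x` and `y` to which `u` and `v` are
tangent, with an identification of it with `ℂ ∪ {∞}` by a stereographic projection under which
`x`, `y` correspond to `X`, `Y` and the tangent vectors `u`, `v` to `a`, `b`, such that
`c = a b / (X - Y)²`. The orientation of the sphere is the one for which the imaginary part of `c`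
is non-negative. -/
def IsInfinitesimalCrossRatio (x y u v : Euc 4) (c : ℂ) : Prop :=
  ∃ (q : Euc 4) (ρ : ℝ) (e : Fin 3 → Euc 4), 0 < ρ ∧ Orthonormal ℝ e ∧
    (∀ ζ, invStereo q ρ e ζ ∈ sphere (0 : Euc 4) 1) ∧
    ∃ X Y a b : ℂ,
      invStereo q ρ e X = x ∧ invStereo q ρ e Y = y ∧
      fderiv ℝ (invStereo q ρ e) X a = u ∧ fderiv ℝ (invStereo q ρ e) Y b = v ∧
      c = a * b / (X - Y) ^ 2 ∧ 0 ≤ c.im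

/-- The pairs of parameters of `K × K ∖ Δ`. -/
def knotPairs (γ : ℝ → Sph 3) : Set (ℝ × ℝ) := {p | γ p.1 ≠ γ p.2}

/-- `c` is the coefficient of `ds ∧ dt` in the infinitesimal cross ratio of the knot at
`(γ s, γ t)`. -/
def IsKnotCrossRatio (γ : ℝ → Sph 3) (p : ℝ × ℝ) (c : ℂ) : Prop :=
  IsInfinitesimalCrossRatio (γ p.1) (γ p.2)
    (deriv (fun s => (γ s : Euc 4)) p.1) (deriv (fun s => (γ s : Euc 4)) p.2) c

/-- The infinitesimal cross ratio `Ω_K`, a complex two-form on `K × K ∖ Δ`, in the parameters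
`(s, t)`. -/
def knotCrossRatio (γ : ℝ → Sph 3) (p : ℝ × ℝ) : (ℝ × ℝ) [⋀^Fin 2]→L[ℝ] ℂ :=
  Classical.epsilon (IsKnotCrossRatio γ p) •
    wedge (Complex.ofRealCLM.comp (ContinuousLinearMap.fst ℝ ℝ ℝ))
      (Complex.ofRealCLM.comp (ContinuousLinearMap.snd ℝ ℝ ℝ))

end

end MoebiusKnot

open MoebiusKnot

/-!
Write `K(x, y) = 1 - ⟪x, y⟫ = ½ |x - y|²`. Tested on a tangent vector `v` of the sphere at `x`, the
covector `φ_x(y)` is `⟪v, y⟫ / K(x, y)`, the derivative of `-log K(·, y)` along `v`. So in a bundle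
chart `φ` is `(q, y) ↦ (q, ∂_q S)` with the generating function `S = -log K`, and `φ^* ω` is the
antisymmetrisation of the mixed derivative `-∂_x ∂_y log K`. This mixed derivative does not change
when `K(x, y)` is multiplied by a function of `x` and a function of `y`.

Moebius maps rescale `K` in this way, because `-K` is the Lorentz product of the lightlike vectors
of `x` and `y`; hence `ω` is invariant. Inverse stereographic projections turn `K` into a rescaled
`|w - z|²`, and `∂_w ∂_z log |w - z|²` is `2 Re 1 / (w - z)²`; hence the formulas for the real parts
of `ω_cr` and `Ω_K`, and `Re Ω_K` is the exterior derivative of `-½ ∂_s log K ds`. The infinitesimal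
cross ratio is unique, because its real part is determined by `ω`, its modulus by conformality,
and its imaginary part is non-negative.
-/

namespace MoebiusKnot

open Filter Topology
open scoped RealInnerProductSpace

section MixedForm

variable {V : Type*} [NormedAddCommGroup V] [InnerProductSpace ℝ V]

/-- The mixed second derivative `-∂_u ∂_v log (1 - ⟪x, y⟫)`, with `u` differentiating in `x` and
`v` in `y`. Antisymmetrised in the two tangent vectors, it is the two-form `ω` of the sphere. -/
noncomputable def mixedForm (x y u v : V) : ℝ :=
  ⟪u, v⟫ / (1 - ⟪x, y⟫) + ⟪u, y⟫ * ⟪x, v⟫ / (1 - ⟪x, y⟫) ^ 2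

theorem mixedForm_smul_smul (x y u v : V) (a b : ℝ) :
    mixedForm x y (a • u) (b • v) = a * b * mixedForm x y u v := by
  simp only [mixedForm, real_inner_smul_left, real_inner_smul_right]
  ring

variable {E F : Type*} [NormedAddCommGroup E] [NormedSpace ℝ E] [NormedAddCommGroup F]
  [NormedSpace ℝ F]

theorem fderiv_inner_div_one_sub_inner {g : E → V} {g' : E →L[ℝ] V} {z : E} {x : V}
    (hg : HasFDerivAt g g' z) (h : 1 - ⟪x, g z⟫ ≠ 0) (u : V) (b : E) :
    fderiv ℝ (fun z => ⟪u, g z⟫ / (1 - ⟪x, g z⟫)) z b = mixedForm x (g z) u (g' b) := by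
  have inner_deriv (w : V) : HasFDerivAt (fun z => ⟪w, g z⟫) ((innerSL ℝ w).comp g') z :=
    (innerSL ℝ w).hasFDerivAt.comp z hg
  have quotient_deriv := (inner_deriv u).mul
    ((hasDerivAt_inv h).comp_hasFDerivAt z ((inner_deriv x).const_sub 1))
  simp only [div_eq_mul_inv]
  refine (DFunLike.congr_fun quotient_deriv.fderiv b).trans ?_
  simp only [mixedForm, Function.comp_apply, add_apply, smul_apply,
    neg_apply, ContinuousLinearMap.comp_apply, innerSL_apply_apply, smul_eq_mul]
  field_simp
  ring

/-- The mixed second logarithmic derivative `∂_a ∂_b log K(x, y)` of a kernel `K`, with `a`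
differentiating in `x` and `b` in `y`. -/
noncomputable def mixedLogDeriv (K : E → F → ℝ) (x : E) (y : F) (a : E) (b : F) : ℝ :=
  fderiv ℝ (fun y' => fderiv ℝ (fun x' => Real.log (K x' y')) x a) y b

/-- `log (c x * d y * K x y)` splits into a sum, and the mixed derivative kills the summands that
depend on one variable only. -/
theorem mixedLogDeriv_eq_of_eventually_eq_mul {K L : E → F → ℝ} {c : E → ℝ} {d : F → ℝ}
    {x : E} {y : F} (hKL : ∀ᶠ y' in 𝓝 y, ∀ᶠ x' in 𝓝 x, K x' y' = c x' * d y' * L x' y')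
    (hc : DifferentiableAt ℝ c x) (hcx : c x ≠ 0) (hd : ∀ᶠ y' in 𝓝 y, d y' ≠ 0)
    (hL : ∀ᶠ y' in 𝓝 y, DifferentiableAt ℝ (L · y') x ∧ L x y' ≠ 0) :
    mixedLogDeriv K x y = mixedLogDeriv L x y := by
  have log_deriv (a : E) : (fun y' => fderiv ℝ (fun x' => Real.log (K x' y')) x a) =ᶠ[𝓝 y]
      fun y' => fderiv ℝ (fun x' => Real.log (c x')) x a
        + fderiv ℝ (fun x' => Real.log (L x' y')) x a := by
    filter_upwards [hKL, hd, hL] with y' hKL hd ⟨hL, hLx⟩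
    have log_split : (fun x' => Real.log (K x' y')) =ᶠ[𝓝 x]
        fun x' => Real.log (c x') + Real.log (L x' y') + Real.log (d y') := by
      filter_upwards [hKL, hc.continuousAt.eventually_ne hcx,
        hL.continuousAt.eventually_ne hLx] with x' hKL hcx' hLx'
      rw [hKL, Real.log_mul (mul_ne_zero hcx' hd) hLx', Real.log_mul hcx' hd]
      ring
    rw [log_split.fderiv_eq, fderiv_add_const, fderiv_fun_add (hc.log hcx) (hL.log hLx),
      add_apply]
  ext a b
  rw [mixedLogDeriv, (log_deriv a).fderiv_eq, fderiv_const_add, mixedLogDeriv]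

theorem mixedForm_eq_neg_mixedLogDeriv {f : E → V} {g : F → V} {f' : E →L[ℝ] V} {g' : F →L[ℝ] V}
    {x : E} {y : F} (hf : HasFDerivAt f f' x) (hg : HasFDerivAt g g' y)
    (h : 1 - ⟪f x, g y⟫ ≠ 0) (a : E) (b : F) :
    mixedForm (f x) (g y) (f' a) (g' b) = -mixedLogDeriv (fun x y => 1 - ⟪f x, g y⟫) x y a b := by
  have first_deriv : (fun y' => fderiv ℝ (fun x' => Real.log (1 - ⟪f x', g y'⟫)) x a) =ᶠ[𝓝 y]
      fun y' => -(⟪f' a, g y'⟫ / (1 - ⟪f x, g y'⟫)) := by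
    have : ContinuousAt (fun y' => 1 - ⟪f x, g y'⟫) y := by
      have := hg.continuousAt
      fun_prop
    filter_upwards [this.eventually_ne h] with y' hy'
    have inner_deriv := hf.inner ℝ (hasFDerivAt_const (g y') x)
    rw [((inner_deriv.const_sub 1).log hy').fderiv]
    simp only [smul_apply, neg_apply,
      ContinuousLinearMap.comp_apply, ContinuousLinearMap.prod_apply,
      zero_apply, fderivInnerCLM_apply, inner_zero_right, smul_eq_mul]
    ring
  rw [mixedLogDeriv, first_deriv.fderiv_eq, fderiv_fun_neg, neg_apply, neg_neg,
    fderiv_inner_div_one_sub_inner hg h]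

theorem mixedForm_eq_neg_mixedLogDeriv_of_eq_mul {f : E → V} {g : F → V} {f' : E →L[ℝ] V}
    {g' : F →L[ℝ] V} {L : E → F → ℝ} {c : E → ℝ} {d : F → ℝ} {x : E} {y : F}
    (hf : HasFDerivAt f f' x) (hg : HasFDerivAt g g' y)
    (h : ∀ᶠ y' in 𝓝 y, ∀ᶠ x' in 𝓝 x, 1 - ⟪f x', g y'⟫ = c x' * d y' * L x' y')
    (hc : DifferentiableAt ℝ c x) (hcx : c x ≠ 0) (hd : ∀ᶠ y' in 𝓝 y, d y' ≠ 0)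
    (hL : ∀ᶠ y' in 𝓝 y, DifferentiableAt ℝ (L · y') x ∧ L x y' ≠ 0) (a : E) (b : F) :
    mixedForm (f x) (g y) (f' a) (g' b) = -mixedLogDeriv L x y a b := by
  have ne_zero : 1 - ⟪f x, g y⟫ ≠ 0 := by
    rw [h.self_of_nhds.self_of_nhds]
    exact mul_ne_zero (mul_ne_zero hcx hd.self_of_nhds) hL.self_of_nhds.2
  rw [mixedForm_eq_neg_mixedLogDeriv hf hg ne_zero,
    mixedLogDeriv_eq_of_eventually_eq_mul h hc hcx hd hL]

end MixedForm

theorem fderiv_log_normSq_sub {x y : ℂ} (hxy : x ≠ y) (a : ℂ) :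
    fderiv ℝ (fun x => Real.log (Complex.normSq (x - y))) x a = 2 * (a / (x - y)).re := by
  have sub_deriv : HasFDerivAt (fun x => x - y) (.id ℝ ℂ) x := (hasFDerivAt_id x).sub_const y
  have normSq_ne : ‖x - y‖ ^ 2 ≠ 0 := by simpa [sub_eq_zero] using hxy
  simp only [Complex.normSq_eq_norm_sq]
  rw [(sub_deriv.norm_sq.log normSq_ne).fderiv, ← Complex.normSq_eq_norm_sq]
  simp only [smul_apply, ContinuousLinearMap.comp_apply, ContinuousLinearMap.id_apply,
    innerSL_apply_apply, Complex.inner, Complex.div_re, Complex.mul_re, Complex.conj_re,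
    Complex.conj_im, smul_eq_mul, nsmul_eq_mul]
  push_cast
  ring

/-- Since `∂_a log |x - y| ^ 2 = 2 Re (a / (x - y))`. -/
theorem mixedLogDeriv_normSq_sub {x y : ℂ} (hxy : x ≠ y) (a b : ℂ) :
    mixedLogDeriv (fun x y : ℂ => Complex.normSq (x - y)) x y a b
      = 2 * (a * b / (x - y) ^ 2).re := by
  have first_deriv : (fun y' => fderiv ℝ (fun x' => Real.log (Complex.normSq (x' - y'))) x a)
      =ᶠ[𝓝 y] fun y' => 2 * Complex.reCLM (a / (x - y')) := by
    filter_upwards [eventually_ne_nhds hxy.symm] with y' hy'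
    exact fderiv_log_normSq_sub hy'.symm a
  have div_deriv : HasDerivAt (fun y' => a / (x - y')) (a / (x - y) ^ 2) y := by
    have := ((hasDerivAt_id y).const_sub x).inv (sub_ne_zero.2 hxy) |>.const_mul a
    simpa [div_eq_mul_inv] using this
  have re_deriv := (Complex.reCLM.hasFDerivAt.comp y
    (div_deriv.hasFDerivAt.restrictScalars ℝ)).const_mul 2
  rw [mixedLogDeriv, first_deriv.fderiv_eq]
  refine (DFunLike.congr_fun re_deriv.fderiv b).trans ?_
  change 2 * (b * (a / (x - y) ^ 2)).re = _
  rw [mul_comm b, div_mul_eq_mul_div]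

section GeneratingFunction

variable {E G V : Type*} [NormedAddCommGroup E] [NormedSpace ℝ E] [NormedAddCommGroup G]
  [NormedSpace ℝ G] [NormedAddCommGroup V] [InnerProductSpace ℝ V]

/-- The momentum `p = ∂S/∂q` of a generating function `S(q, y)`. -/
noncomputable def momentum (S : E × G → ℝ) (z : E × G) : E →L[ℝ] ℝ :=
  (fderiv ℝ S z).comp (.inl ℝ E G)

/-- The map `(q, y) ↦ (q, ∂S/∂q)` into phase space that is generated by `S(q, y)`. -/
noncomputable def generatedMap (S : E × G → ℝ) (z : E × G) : E × (E →L[ℝ] ℝ) :=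
  (z.1, momentum S z)

variable {S : E × G → ℝ} {z : E × G}

theorem contDiffAt_momentum {m n : ℕ∞ω} (hS : ContDiffAt ℝ n S z) (hmn : m + 1 ≤ n) :
    ContDiffAt ℝ m (momentum S) z :=
  (hS.fderiv_right hmn).clm_comp contDiffAt_const

theorem fderiv_momentum_apply (hS : ContDiffAt ℝ 2 S z) (w : E × G) (a : E) :
    fderiv ℝ (momentum S) z w a = fderiv ℝ (fderiv ℝ S) z w (a, 0) := by
  have hS' : HasFDerivAt (fderiv ℝ S) (fderiv ℝ (fderiv ℝ S) z) z :=
    ((hS.fderiv_right (m := 1) (by norm_num)).differentiableAt one_ne_zero).hasFDerivAt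
  have momentum_deriv := hS'.clm_comp (hasFDerivAt_const (ContinuousLinearMap.inl ℝ E G) z)
  refine (congrArg (fun L : (E × G) →L[ℝ] E →L[ℝ] ℝ => L w a) momentum_deriv.fderiv).trans ?_
  simp

theorem fderiv_momentum_snd_apply (hS : ContDiffAt ℝ 2 S z) (a : E) (b : G) :
    fderiv ℝ (fun y => momentum S (z.1, y) a) z.2 b = fderiv ℝ (momentum S) z (0, b) a := by
  have hP : DifferentiableAt ℝ (momentum S) z :=
    (contDiffAt_momentum (m := 1) hS (by norm_num)).differentiableAt one_ne_zero
  have partial_deriv := (ContinuousLinearMap.apply ℝ ℝ a).hasFDerivAt.comp z.2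
    (HasFDerivAt.comp z.2 hP.hasFDerivAt (hasFDerivAt_prodMk_right z.1 z.2))
  refine (DFunLike.congr_fun partial_deriv.fderiv b).trans ?_
  simp

/-- The symmetry of the second derivative of `S` in `q` cancels all but the mixed terms. -/
theorem fderiv_momentum_apply_sub (hS : ContDiffAt ℝ 2 S z) (w w' : E × G) :
    fderiv ℝ (momentum S) z w' w.1 - fderiv ℝ (momentum S) z w w'.1 =
      fderiv ℝ (fun y => momentum S (z.1, y) w.1) z.2 w'.2
        - fderiv ℝ (fun y => momentum S (z.1, y) w'.1) z.2 w.2 := by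
  have split (w : E × G) : w = (w.1, 0) + (0, w.2) := by simp
  have symm := hS.isSymmSndFDerivAt (by simp) (w'.1, 0) (w.1, 0)
  simp only [fderiv_momentum_snd_apply hS, fderiv_momentum_apply hS]
  rw [split w', split w]
  simp only [map_add, add_apply, Prod.fst_add, Prod.snd_add, add_zero, zero_add]
  rw [symm]
  ring

theorem sum_wedge_qCoord_pCoord_apply {m : ℕ} (w : Fin 2 → Euc m × (Euc m →L[ℝ] ℝ)) :
    (∑ i : Fin m, wedge (qCoord i) (pCoord i)) w = (w 1).2 (w 0).1 - (w 0).2 (w 1).1 := by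
  have sum_coord (β : Euc m →L[ℝ] ℝ) (v : Euc m) :
      ∑ i, v i * β (EuclideanSpace.single i (1 : ℝ)) = β v := by
    conv_rhs => rw [← (EuclideanSpace.basisFun (Fin m) ℝ).sum_repr v, map_sum]
    simp
  rw [ContinuousAlternatingMap.sum_apply, ← sum_coord, ← sum_coord, ← Finset.sum_sub_distrib]
  rfl

theorem sum_wedge_fderiv_generatedMap {m : ℕ} {S : Euc m × G → ℝ} {z : Euc m × G}
    (hS : ContDiffAt ℝ 2 S z) (w : Fin 2 → Euc m × G) :
    (∑ i : Fin m, wedge (qCoord i) (pCoord i)) (fun i => fderiv ℝ (generatedMap S) z (w i)) =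
      fderiv ℝ (fun y => momentum S (z.1, y) (w 0).1) z.2 (w 1).2
        - fderiv ℝ (fun y => momentum S (z.1, y) (w 1).1) z.2 (w 0).2 := by
  have hP : DifferentiableAt ℝ (momentum S) z :=
    (contDiffAt_momentum (m := 1) hS (by norm_num)).differentiableAt one_ne_zero
  have generated_deriv : fderiv ℝ (generatedMap S) z =
      (ContinuousLinearMap.fst ℝ (Euc m) G).prod (fderiv ℝ (momentum S) z) :=
    (hasFDerivAt_fst.prodMk hP.hasFDerivAt).fderiv
  rw [sum_wedge_qCoord_pCoord_apply, generated_deriv, ← fderiv_momentum_apply_sub hS]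
  rfl

/-- The generating function `S(q, y) = -log (1 - ⟪ι q, y⟫)` attached to a map `ι` into an inner
product space; for a local parametrization `ι` of the unit sphere it generates `φ`. -/
noncomputable def logPotential (ι : E → V) (z : E × V) : ℝ :=
  -Real.log (1 - ⟪ι z.1, z.2⟫)

variable {ι : E → V} {q : E} {y : V}

theorem contDiffAt_logPotential {n : ℕ∞ω} (hι : ContDiffAt ℝ n ι q) (h : 1 - ⟪ι q, y⟫ ≠ 0) :
    ContDiffAt ℝ n (logPotential ι) (q, y) :=
  ((contDiffAt_const.sub (hι.fst'.inner ℝ contDiffAt_snd)).log h).neg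

theorem momentum_logPotential_apply (hι : DifferentiableAt ℝ ι q) (h : 1 - ⟪ι q, y⟫ ≠ 0)
    (a : E) :
    momentum (logPotential ι) (q, y) a = ⟪fderiv ℝ ι q a, y⟫ / (1 - ⟪ι q, y⟫) := by
  have hι' : HasFDerivAt (fun z : E × V => ι z.1) ((fderiv ℝ ι q).comp (.fst ℝ E V)) (q, y) :=
    hι.hasFDerivAt.comp (q, y) hasFDerivAt_fst
  have potential_deriv : HasFDerivAt (logPotential ι) _ (q, y) :=
    (((hι'.inner ℝ hasFDerivAt_snd).const_sub 1).log h).neg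
  rw [momentum, potential_deriv.fderiv]
  simp [div_eq_inv_mul]

theorem fderiv_momentum_logPotential (hι : DifferentiableAt ℝ ι q) (h : 1 - ⟪ι q, y⟫ ≠ 0)
    (a : E) (b : V) :
    fderiv ℝ (fun y => momentum (logPotential ι) (q, y) a) y b =
      mixedForm (ι q) y (fderiv ℝ ι q a) b := by
  have momentum_eq : (fun y => momentum (logPotential ι) (q, y) a) =ᶠ[𝓝 y]
      fun y => ⟪fderiv ℝ ι q a, y⟫ / (1 - ⟪ι q, y⟫) := by
    have : ContinuousAt (fun y => 1 - ⟪ι q, y⟫) y := by fun_prop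
    filter_upwards [this.eventually_ne h] with y' hy'
    exact momentum_logPotential_apply hι hy' a
  rw [momentum_eq.fderiv_eq]
  exact fderiv_inner_div_one_sub_inner (hasFDerivAt_id y) h _ b

end GeneratingFunction

section Sphere

variable {n : ℕ}

theorem inner_self_sph (x : Sph n) : ⟪(x : Euc (n + 1)), x⟫ = 1 := by
  rw [real_inner_self_eq_norm_sq, norm_eq_of_mem_sphere, one_pow]

theorem one_sub_inner_pos {x y : Sph n} (h : x ≠ y) : 0 < 1 - ⟪(x : Euc (n + 1)), y⟫ :=
  sub_pos.2 ((inner_lt_one_iff_real_of_norm_eq_one (norm_eq_of_mem_sphere x)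
    (norm_eq_of_mem_sphere y)).2 (Subtype.coe_ne_coe.2 h))

theorem contMDiff_coe_sph {m : ℕ∞ω} :
    ContMDiff (𝓡 n) 𝓘(ℝ, Euc (n + 1)) m (fun z : Sph n => (z : Euc (n + 1))) :=
  have : Fact (Module.finrank ℝ (Euc (n + 1)) = n + 1) := ⟨finrank_euclideanSpace_fin⟩
  contMDiff_coe_sphere

/-- The differential at `x` of the inclusion of the sphere, identifying the tangent space with
the orthogonal complement of `x`. -/
noncomputable def tangentInclusion (x : Sph n) : TangentSpace (𝓡 n) x →L[ℝ] Euc (n + 1) :=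
  mfderiv (𝓡 n) 𝓘(ℝ, Euc (n + 1)) (fun z : Sph n => (z : Euc (n + 1))) x

theorem hasMFDerivAt_coe_sph (x : Sph n) :
    HasMFDerivAt (𝓡 n) 𝓘(ℝ, Euc (n + 1)) (fun z : Sph n => (z : Euc (n + 1))) x
      (tangentInclusion x) :=
  ((contMDiff_coe_sph (m := 1)).mdifferentiableAt one_ne_zero).hasMFDerivAt

theorem tangentInclusion_injective (x : Sph n) : Function.Injective (tangentInclusion x) :=
  have : Fact (Module.finrank ℝ (Euc (n + 1)) = n + 1) := ⟨finrank_euclideanSpace_fin⟩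
  injective_mvfderiv_subtypeVal_sphere x

theorem range_tangentInclusion (x : Sph n) :
    (tangentInclusion x).range = (ℝ ∙ (x : Euc (n + 1)))ᗮ :=
  have : Fact (Module.finrank ℝ (Euc (n + 1)) = n + 1) := ⟨finrank_euclideanSpace_fin⟩
  range_mvfderiv_subtypeVal x

theorem tangentInclusion_mem_orthogonal (x : Sph n) (u : TangentSpace (𝓡 n) x) :
    tangentInclusion x u ∈ (ℝ ∙ (x : Euc (n + 1)))ᗮ :=
  range_tangentInclusion x ▸ LinearMap.mem_range_self _ u

theorem inner_tangentInclusion_self (x : Sph n) (u : TangentSpace (𝓡 n) x) :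
    ⟪(x : Euc (n + 1)), tangentInclusion x u⟫ = 0 :=
  Submodule.mem_orthogonal_singleton_iff_inner_right.1 (tangentInclusion_mem_orthogonal x u)

theorem stereo_eq_smul_stereographic (x y : Sph n) :
    stereo x y = (2⁻¹ : ℝ) • (stereographic (norm_eq_of_mem_sphere x) y : Euc (n + 1)) := by
  rw [stereographic_apply, Submodule.coe_smul, ← Submodule.starProjection_apply,
    Submodule.starProjection_orthogonal_val,
    Submodule.starProjection_unit_singleton ℝ (norm_eq_of_mem_sphere x), smul_smul, stereo]
  congr 1
  ring

theorem bijOn_stereo (x : Sph n) :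
    BijOn (stereo x) {y | x ≠ y} ((ℝ ∙ (x : Euc (n + 1)))ᗮ : Submodule ℝ (Euc (n + 1))) := by
  have source_eq : {y | x ≠ y} = (stereographic (norm_eq_of_mem_sphere x)).source :=
    Set.ext fun y => ne_comm
  have half_bijOn : BijOn (fun w : (ℝ ∙ (x : Euc (n + 1)))ᗮ => (2⁻¹ : ℝ) • (w : Euc (n + 1))) univ
      ((ℝ ∙ (x : Euc (n + 1)))ᗮ : Submodule ℝ (Euc (n + 1))) := by
    refine ⟨fun w _ => Submodule.smul_mem _ _ w.2, fun w _ w' _ h => ?_, fun v hv => ?_⟩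
    · exact Subtype.ext (smul_right_injective _ (inv_ne_zero two_ne_zero) h)
    · exact ⟨⟨(2 : ℝ) • v, Submodule.smul_mem _ _ hv⟩, mem_univ _, by simp⟩
  rw [source_eq, show stereo x = _ from funext (stereo_eq_smul_stereographic x)]
  exact half_bijOn.comp (stereographic (norm_eq_of_mem_sphere x)).bijOn

theorem bijOn_inner_tangentInclusion (x : Sph n) :
    BijOn (fun v => (innerSL ℝ v).comp (tangentInclusion x))
      ((ℝ ∙ (x : Euc (n + 1)))ᗮ : Submodule ℝ (Euc (n + 1))) univ := by
  refine ⟨mapsTo_univ _ _, fun v hv w hw hvw => ?_, fun ξ _ => ?_⟩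
  · have sub_mem : v - w ∈ (tangentInclusion x).range :=
      range_tangentInclusion x ▸ Submodule.sub_mem _ hv hw
    obtain ⟨u, hu⟩ := sub_mem
    have inner_eq : ⟪v, tangentInclusion x u⟫ = ⟪w, tangentInclusion x u⟫ :=
      DFunLike.congr_fun hvw u
    rw [← sub_eq_zero, ← inner_sub_left] at inner_eq
    rw [← sub_eq_zero, ← inner_self_eq_zero (𝕜 := ℝ)]
    exact (congrArg _ hu.symm).trans inner_eq
  · obtain ⟨g, hg⟩ := LinearMap.exists_leftInverse_of_injective (tangentInclusion x).toLinearMap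
      (LinearMap.ker_eq_bot.2 (tangentInclusion_injective x))
    let riesz := (InnerProductSpace.toDual ℝ (Euc (n + 1))).symm
      (LinearMap.toContinuousLinearMap (ξ.toLinearMap.comp g))
    refine ⟨(ℝ ∙ (x : Euc (n + 1)))ᗮ.starProjection riesz,
      Submodule.starProjection_apply_mem _ _, ContinuousLinearMap.ext fun u => ?_⟩
    rw [ContinuousLinearMap.comp_apply, innerSL_apply_apply,
      Submodule.inner_starProjection_left_eq_right,
      Submodule.starProjection_eq_self_iff.2 (tangentInclusion_mem_orthogonal x u),
      InnerProductSpace.toDual_symm_apply]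
    exact congrArg ξ (LinearMap.congr_fun hg u)

theorem bijOn_toCovector (x : Sph n) : BijOn (toCovector x) {y | x ≠ y} univ :=
  (bijOn_inner_tangentInclusion x).comp (bijOn_stereo x)

theorem bijOn_toCotangent (n : ℕ) : BijOn (toCotangent n) (distinctPairs (Sph n)) univ := by
  refine ⟨mapsTo_univ _ _, ?_, ?_⟩
  · rintro ⟨x, y⟩ hxy ⟨x', y'⟩ hxy' h
    obtain rfl : x = x' := congrArg Bundle.TotalSpace.proj h
    have covector_eq : toCovector x y = toCovector x y' := by simpa [toCotangent] using h
    exact Prod.ext rfl ((bijOn_toCovector x).injOn hxy hxy' covector_eq)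
  · rintro ⟨x, ξ⟩ -
    obtain ⟨y, hxy, rfl⟩ := (bijOn_toCovector x).surjOn (mem_univ ξ)
    exact ⟨(x, y), hxy, rfl⟩

end Sphere

section CotangentChart

theorem trivializationAt_cotangent_snd {m : ℕ} {M : Type*} [TopologicalSpace M]
    [ChartedSpace (Euc m) M] [IsManifold (𝓡 m) ∞ M] {x₀ x : M}
    (hx : x ∈ (chartAt (Euc m) x₀).source) (ξ : TangentSpace (𝓡 m) x →L[ℝ] ℝ) :
    (trivializationAt (Euc m →L[ℝ] ℝ)
      (fun x : M => TangentSpace (𝓡 m) x →L[ℝ] Bundle.Trivial M ℝ x) x₀ ⟨x, ξ⟩).2 =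
    ξ.comp (mfderivWithin 𝓘(ℝ, Euc m) (𝓡 m) (extChartAt (𝓡 m) x₀).symm (range (𝓡 m))
      (extChartAt (𝓡 m) x₀ x)) := by
  rw [hom_trivializationAt_apply, ContinuousLinearMap.inCoordinates,
    TangentBundle.symmL_trivializationAt hx]
  ext e
  exact DFunLike.congr_fun (Bundle.Trivial.continuousLinearMapAt_trivialization ℝ M ℝ x) _

variable {n : ℕ}

/-- The local parametrization of the sphere, as a map into the ambient space, that is inverse to
the preferred chart at `x₀`. -/
noncomputable def chartInclusion (x₀ : Sph n) (q : Euc n) : Euc (n + 1) :=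
  ((extChartAt (𝓡 n) x₀).symm q : Sph n)

theorem extChartAt_sph_target (x₀ : Sph n) : (extChartAt (𝓡 n) x₀).target = univ := by
  rw [extChartAt_target]
  simp [chartAt, ChartedSpace.chartAt]

theorem contDiff_chartInclusion (x₀ : Sph n) : ContDiff ℝ ∞ (chartInclusion x₀) := by
  rw [← contMDiff_iff_contDiff, ← contMDiffOn_univ, ← extChartAt_sph_target x₀]
  exact contMDiff_coe_sph.comp_contMDiffOn (contMDiffOn_extChartAt_symm x₀)

theorem chartInclusion_extChartAt {x₀ x : Sph n} (hx : x ∈ (chartAt (Euc n) x₀).source) :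
    chartInclusion x₀ (extChartAt (𝓡 n) x₀ x) = x :=
  congrArg Subtype.val ((extChartAt (𝓡 n) x₀).left_inv (by rwa [extChartAt_source]))

theorem fderiv_chartInclusion {x₀ x : Sph n} (hx : x ∈ (chartAt (Euc n) x₀).source) :
    fderiv ℝ (chartInclusion x₀) (extChartAt (𝓡 n) x₀ x) =
      (tangentInclusion x).comp (mfderivWithin 𝓘(ℝ, Euc n) (𝓡 n) (extChartAt (𝓡 n) x₀).symm
        (range (𝓡 n)) (extChartAt (𝓡 n) x₀ x)) := by
  have mem_source : x ∈ (extChartAt (𝓡 n) x₀).source := by rwa [extChartAt_source]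
  have chain := mfderiv_comp_mfderivWithin (extChartAt (𝓡 n) x₀ x)
    ((contMDiff_coe_sph (m := 1)).mdifferentiableAt one_ne_zero)
    (mdifferentiableWithinAt_extChartAt_symm ((extChartAt (𝓡 n) x₀).map_source mem_source))
    (by simp [uniqueMDiffWithinAt_univ])
  rw [(extChartAt (𝓡 n) x₀).left_inv mem_source] at chain
  refine Eq.trans ?_ chain
  rw [← mfderiv_eq_fderiv]
  simp only [modelWithCornersSelf_coe, range_id, mfderivWithin_univ]
  rfl

theorem fderiv_chartInclusion_mfderiv_extChartAt (x : Sph n) (u : TangentSpace (𝓡 n) x) :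
    fderiv ℝ (chartInclusion x) (extChartAt (𝓡 n) x x)
      (mfderiv (𝓡 n) 𝓘(ℝ, Euc n) (extChartAt (𝓡 n) x) x u) = tangentInclusion x u := by
  have chain := mfderiv_comp x
    ((contDiff_chartInclusion x).differentiable (by simp) (extChartAt (𝓡 n) x x)).mdifferentiableAt
    ((contMDiffAt_extChartAt (I := 𝓡 n) (n := 1) (x := x)).mdifferentiableAt one_ne_zero)
  have comp_eq : chartInclusion x ∘ extChartAt (𝓡 n) x =ᶠ[𝓝 x]
      fun z : Sph n => (z : Euc (n + 1)) := by
    filter_upwards [chart_source_mem_nhds (Euc n) x] with z hz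
    exact chartInclusion_extChartAt hz
  rw [comp_eq.mfderiv_eq, mfderiv_eq_fderiv] at chain
  exact (DFunLike.congr_fun chain u).symm

/-- The coordinates `(q, y)` in which `φ` is generated by `logPotential`. -/
noncomputable def chartPair (x₀ : Sph n) (p : Sph n × Sph n) : Euc n × Euc (n + 1) :=
  (extChartAt (𝓡 n) x₀ p.1, p.2)

theorem contMDiffAt_chartPair (p : Sph n × Sph n) :
    ContMDiffAt (pairModel n) 𝓘(ℝ, Euc n × Euc (n + 1)) ∞ (chartPair p.1) p :=
  (ContMDiffAt.comp p contMDiffAt_extChartAt contMDiffAt_fst).prodMk_space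
    (contMDiff_coe_sph.comp contMDiff_snd).contMDiffAt

theorem hasMFDerivAt_chartPair (p : Sph n × Sph n) :
    HasMFDerivAt (pairModel n) 𝓘(ℝ, Euc n × Euc (n + 1)) (chartPair p.1) p
      (((mfderiv (𝓡 n) 𝓘(ℝ, Euc n) (extChartAt (𝓡 n) p.1) p.1).comp
          (ContinuousLinearMap.fst ℝ (Euc n) (Euc n))).prod
        ((tangentInclusion p.2).comp (ContinuousLinearMap.snd ℝ (Euc n) (Euc n)))) := by
  have chart_deriv : HasMFDerivAt (𝓡 n) 𝓘(ℝ, Euc n) (extChartAt (𝓡 n) p.1) p.1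
      (mfderiv (𝓡 n) 𝓘(ℝ, Euc n) (extChartAt (𝓡 n) p.1) p.1) :=
    ((contMDiffAt_extChartAt (n := 1)).mdifferentiableAt one_ne_zero).hasMFDerivAt
  have prod_deriv := HasMFDerivAt.prodMk
    (chart_deriv.comp p (hasMFDerivAt_fst (I := 𝓡 n) (I' := 𝓡 n) p))
    ((hasMFDerivAt_coe_sph p.2).comp p (hasMFDerivAt_snd (I := 𝓡 n) (I' := 𝓡 n) p))
  rw [← modelWithCornersSelf_prod] at prod_deriv
  exact prod_deriv

theorem eventually_fst_mem_chart_source (p : Sph n × Sph n) :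
    ∀ᶠ p' in 𝓝 p, p'.1 ∈ (chartAt (Euc n) p.1).source :=
  continuousAt_fst.eventually_mem (chart_source_mem_nhds (Euc n) p.1)

theorem isOpen_distinctPairs (X : Type*) [TopologicalSpace X] [T2Space X] :
    IsOpen (distinctPairs X) :=
  isClosed_diagonal.isOpen_compl

theorem toCovector_apply (x y : Sph n) (u : TangentSpace (𝓡 n) x) :
    toCovector x y u = ⟪tangentInclusion x u, (y : Euc (n + 1))⟫ /
      (1 - ⟪(x : Euc (n + 1)), (y : Euc (n + 1))⟫) := by
  change ⟪stereo x y, tangentInclusion x u⟫ = _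
  rw [stereo, real_inner_smul_left, inner_sub_left, real_inner_smul_left,
    inner_tangentInclusion_self, mul_zero, sub_zero, real_inner_comm (tangentInclusion x u),
    div_eq_inv_mul]

theorem trivializationAt_toCotangent_snd {x₀ : Sph n} {p : Sph n × Sph n}
    (hp : p ∈ distinctPairs (Sph n)) (hx : p.1 ∈ (chartAt (Euc n) x₀).source) :
    (trivializationAt (Euc n →L[ℝ] ℝ)
      (fun x : Sph n => TangentSpace (𝓡 n) x →L[ℝ] Bundle.Trivial (Sph n) ℝ x) x₀
      (toCotangent n p)).2 = momentum (logPotential (chartInclusion x₀)) (chartPair x₀ p) := by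
  have chart_eq := chartInclusion_extChartAt hx
  ext e
  rw [chartPair, momentum_logPotential_apply
    ((contDiff_chartInclusion x₀).differentiable (by simp) _)
    (chart_eq.symm ▸ (one_sub_inner_pos hp).ne'), chart_eq, fderiv_chartInclusion hx]
  exact (DFunLike.congr_fun (trivializationAt_cotangent_snd hx _) e).trans
    (toCovector_apply p.1 p.2 _)

theorem contDiffAt_logPotential_chartPair {p : Sph n × Sph n} (hp : p ∈ distinctPairs (Sph n)) :
    ContDiffAt ℝ ∞ (logPotential (chartInclusion p.1)) (chartPair p.1 p) := by
  refine contDiffAt_logPotential (contDiff_chartInclusion p.1).contDiffAt ?_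
  rw [chartInclusion_extChartAt (mem_chart_source _ p.1)]
  exact (one_sub_inner_pos hp).ne'

theorem contMDiffAt_toCotangent {p : Sph n × Sph n} (hp : p ∈ distinctPairs (Sph n)) :
    ContMDiffAt (pairModel n) (cotangentModel n) ∞ (toCotangent n) p := by
  rw [Bundle.contMDiffAt_totalSpace]
  refine ⟨contMDiffAt_fst, ContMDiffAt.congr_of_eventuallyEq
    (ContMDiffAt.comp p (contDiffAt_momentum (contDiffAt_logPotential_chartPair hp)
      (by simp)).contMDiffAt (contMDiffAt_chartPair p)) ?_⟩
  filter_upwards [eventually_fst_mem_chart_source p, (isOpen_distinctPairs _).mem_nhds hp]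
    with p' hx hp'
  exact trivializationAt_toCotangent_snd hp' hx

theorem extChartAt_comp_toCotangent {p : Sph n × Sph n} (hp : p ∈ distinctPairs (Sph n)) :
    (extChartAt (cotangentModel n) (toCotangent n p)) ∘ toCotangent n =ᶠ[𝓝 p]
      generatedMap (logPotential (chartInclusion p.1)) ∘ chartPair p.1 := by
  filter_upwards [eventually_fst_mem_chart_source p, (isOpen_distinctPairs _).mem_nhds hp]
    with p' hx hp'
  rw [Function.comp_apply, FiberBundle.extChartAt]
  exact Prod.ext rfl (trivializationAt_toCotangent_snd hp' hx)

theorem omegaSphere_eq_sum_wedge {p : Sph n × Sph n} (hp : p ∈ distinctPairs (Sph n))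
    (w : Fin 2 → TangentSpace (pairModel n) p) :
    omegaSphere n p w = (∑ i : Fin n, wedge (qCoord i) (pCoord i)) fun i =>
      fderiv ℝ (generatedMap (logPotential (chartInclusion p.1))) (chartPair p.1 p)
        (mfderiv (𝓡 n) 𝓘(ℝ, Euc n) (extChartAt (𝓡 n) p.1) p.1 (w i).1,
          tangentInclusion p.2 (w i).2) := by
  have hS := contDiffAt_logPotential_chartPair hp
  have generated_diff : DifferentiableAt ℝ
      (generatedMap (logPotential (chartInclusion p.1))) (chartPair p.1 p) :=
    differentiableAt_fst.prodMk
      ((contDiffAt_momentum (m := ∞) hS (by simp)).differentiableAt (by simp))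
  have chain := mfderiv_comp p
    ((contMDiffAt_extChartAt (n := 1)).mdifferentiableAt one_ne_zero)
    ((contMDiffAt_toCotangent hp).mdifferentiableAt (by simp))
  rw [(extChartAt_comp_toCotangent hp).mfderiv_eq,
    (generated_diff.hasFDerivAt.hasMFDerivAt.comp p (hasMFDerivAt_chartPair p)).mfderiv] at chain
  exact congrArg (DFunLike.coe (∑ i : Fin n, wedge (qCoord i) (pCoord i)))
    (funext fun i => DFunLike.congr_fun chain.symm (w i))

theorem omegaSphere_apply {p : Sph n × Sph n} (hp : p ∈ distinctPairs (Sph n))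
    (w : Fin 2 → TangentSpace (pairModel n) p) :
    omegaSphere n p w =
      mixedForm (p.1 : Euc (n + 1)) p.2 (tangentInclusion p.1 (w 0).1)
        (tangentInclusion p.2 (w 1).2) -
      mixedForm (p.1 : Euc (n + 1)) p.2 (tangentInclusion p.1 (w 1).1)
        (tangentInclusion p.2 (w 0).2) := by
  have chart_eq := chartInclusion_extChartAt (mem_chart_source (Euc n) p.1)
  have mixed_eq (u : TangentSpace (𝓡 n) p.1) (b : Euc (n + 1)) :
      fderiv ℝ (fun y => momentum (logPotential (chartInclusion p.1))
        (extChartAt (𝓡 n) p.1 p.1, y) (mfderiv (𝓡 n) 𝓘(ℝ, Euc n) (extChartAt (𝓡 n) p.1) p.1 u))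
        p.2 b = mixedForm (p.1 : Euc (n + 1)) p.2 (tangentInclusion p.1 u) b := by
    refine (fderiv_momentum_logPotential ((contDiff_chartInclusion p.1).differentiable (by simp) _)
      (chart_eq.symm ▸ (one_sub_inner_pos hp).ne') _ _).trans ?_
    rw [chart_eq, fderiv_chartInclusion_mfderiv_extChartAt]
  rw [omegaSphere_eq_sum_wedge hp, sum_wedge_fderiv_generatedMap
    ((contDiffAt_logPotential_chartPair hp).of_le (WithTop.coe_le_coe.2 (le_top (a := (2 : ℕ∞)))))]
  exact congrArg₂ (· - ·) (mixed_eq (w 0).1 _) (mixed_eq (w 1).1 _)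

variable {E H M : Type*} [NormedAddCommGroup E] [NormedSpace ℝ E] [TopologicalSpace H]
  {I : ModelWithCorners ℝ E H} [TopologicalSpace M] [ChartedSpace H M]

theorem contMDiff_sph_of_coe {m : ℕ∞ω} [IsManifold I m M] {f : M → Sph n}
    (hf : ContMDiff I 𝓘(ℝ, Euc (n + 1)) m (fun z => (f z : Euc (n + 1)))) :
    ContMDiff I (𝓡 n) m f :=
  have : Fact (Module.finrank ℝ (Euc (n + 1)) = n + 1) := ⟨finrank_euclideanSpace_fin⟩
  hf.codRestrict_sphere (n := n) fun x => (f x).2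

theorem tangentInclusion_apply_of_hasMFDerivAt {f : M → Sph n} {z : M}
    {f' : TangentSpace I z →L[ℝ] Euc (n + 1)}
    (hf : MDifferentiableAt I (𝓡 n) f z)
    (hf' : HasMFDerivAt I 𝓘(ℝ, Euc (n + 1)) (fun z => (f z : Euc (n + 1))) z f')
    (u : TangentSpace I z) :
    tangentInclusion (f z) (mfderiv I (𝓡 n) f z u) = f' u :=
  DFunLike.congr_fun (hasMFDerivAt_unique ((hasMFDerivAt_coe_sph (f z)).comp z hf.hasMFDerivAt)
    hf') u

theorem pullback_omegaSphere_prodMk_apply {f g : M → Sph n} {z : M}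
    {f' g' : TangentSpace I z →L[ℝ] Euc (n + 1)}
    (hf : MDifferentiableAt I (𝓡 n) f z) (hg : MDifferentiableAt I (𝓡 n) g z)
    (hf' : HasMFDerivAt I 𝓘(ℝ, Euc (n + 1)) (fun z => (f z : Euc (n + 1))) z f')
    (hg' : HasMFDerivAt I 𝓘(ℝ, Euc (n + 1)) (fun z => (g z : Euc (n + 1))) z g')
    (hfg : f z ≠ g z) (w : Fin 2 → TangentSpace I z) :
    pullback I (pairModel n) (fun z => (f z, g z)) (omegaSphere n) z w =
      mixedForm (f z : Euc (n + 1)) (g z) (f' (w 0)) (g' (w 1)) -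
      mixedForm (f z : Euc (n + 1)) (g z) (f' (w 1)) (g' (w 0)) := by
  rw [pullback, (hf.hasMFDerivAt.prodMk hg.hasMFDerivAt).mfderiv]
  refine (omegaSphere_apply (p := (f z, g z)) hfg _).trans ?_
  simp only [← tangentInclusion_apply_of_hasMFDerivAt hf hf',
    ← tangentInclusion_apply_of_hasMFDerivAt hg hg']
  rfl

end CotangentChart

section Moebius

/-- The Lorentz form `⟪x, y⟫ - a b` on `ℝ × ℝ^m`. -/
noncomputable def lorentzForm {m : ℕ} (X Y : ℝ × Euc m) : ℝ := ⟪X.2, Y.2⟫ - X.1 * Y.1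

theorem lorentzForm_smul_smul {m : ℕ} (a b : ℝ) (X Y : ℝ × Euc m) :
    lorentzForm (a • X) (b • Y) = a * b * lorentzForm X Y := by
  simp only [lorentzForm, Prod.smul_fst, Prod.smul_snd, real_inner_smul_left,
    real_inner_smul_right, smul_eq_mul]
  ring

theorem one_sub_inner_eq_neg_lorentzForm {m : ℕ} (x y : Euc m) :
    1 - ⟪x, y⟫ = -lorentzForm (1, x) (1, y) := by
  simp [lorentzForm]

/-- The identification of `ℝ × ℝ^m` with `ℝ^(m+1)` that puts the first factor in front. -/
noncomputable def consEquiv (m : ℕ) : (ℝ × Euc m) ≃ₗ[ℝ] (Fin (m + 1) → ℝ) :=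
  ((LinearEquiv.refl ℝ ℝ).prodCongr (WithLp.linearEquiv 2 ℝ (Fin m → ℝ))).trans
    (Fin.consLinearEquiv ℝ (fun _ : Fin (m + 1) => ℝ))

theorem consEquiv_apply {m : ℕ} (X : ℝ × Euc m) :
    consEquiv m X = Fin.cons X.1 (fun i => X.2 i) := rfl

theorem dotProduct_lorentzGram_mulVec {n : ℕ} (X Y : ℝ × Euc (n + 1)) :
    consEquiv (n + 1) X ⬝ᵥ (lorentzGram n).mulVec (consEquiv (n + 1) Y) = lorentzForm X Y := by
  rw [consEquiv_apply, consEquiv_apply, lorentzGram, lorentzForm, dotProduct, Fin.sum_univ_succ]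
  simp only [Matrix.mulVec_diagonal, Fin.cons_zero, Fin.cons_succ, PiLp.inner_apply,
    RCLike.inner_apply, conj_trivial, one_mul, mul_comm]
  ring

/-- `M` is a Lorentz transformation of `ℝ × ℝ^(n+1)` that induces `T` on the lines of the light
cone, the point `x` of the sphere being identified with the line spanned by `(1, x)`. -/
structure IsLorentzLift {n : ℕ} (M : (ℝ × Euc (n + 1)) →L[ℝ] (ℝ × Euc (n + 1)))
    (T : Sph n → Sph n) : Prop where
  lorentzForm_map : ∀ X Y, lorentzForm (M X) (M Y) = lorentzForm X Y
  exists_smul : ∀ x : Sph n, ∃ c : ℝ, c ≠ 0 ∧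
    M (1, (x : Euc (n + 1))) = c • ((1 : ℝ), (T x : Euc (n + 1)))

theorem IsMoebius.exists_isLorentzLift {n : ℕ} {T : Sph n → Sph n} (hT : IsMoebius T) :
    ∃ M, IsLorentzLift M T := by
  obtain ⟨A, hA, hAT⟩ := hT
  let M : (ℝ × Euc (n + 1)) →L[ℝ] (ℝ × Euc (n + 1)) :=
    LinearMap.toContinuousLinearMap ((consEquiv (n + 1)).symm.toLinearMap.comp
      (A.mulVecLin.comp (consEquiv (n + 1)).toLinearMap))
  have consEquiv_map (X) : consEquiv (n + 1) (M X) = A.mulVec (consEquiv (n + 1) X) :=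
    LinearEquiv.apply_symm_apply _ _
  refine ⟨M, fun X Y => ?_, fun x => ?_⟩
  · rw [← dotProduct_lorentzGram_mulVec, consEquiv_map, consEquiv_map,
      ← dotProduct_lorentzGram_mulVec, Matrix.mulVec_mulVec, ← Matrix.vecMul_transpose,
      ← Matrix.dotProduct_mulVec, Matrix.mulVec_mulVec, ← Matrix.mul_assoc, hA]
  · obtain ⟨c, hc, h⟩ := hAT x
    refine ⟨c, hc, (consEquiv (n + 1)).injective ?_⟩
    rw [consEquiv_map, map_smul]
    exact h

/-- The action of a linear map of `ℝ × ℝ^m` on the affine chart `{1} × ℝ^m` of the projective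
space. -/
noncomputable def projAction {m : ℕ} (M : (ℝ × Euc m) →L[ℝ] (ℝ × Euc m)) (z : Euc m) : Euc m :=
  (M (1, z)).1⁻¹ • (M (1, z)).2

theorem contDiff_map_one_prodMk {m : ℕ} (M : (ℝ × Euc m) →L[ℝ] (ℝ × Euc m)) :
    ContDiff ℝ ∞ (fun z => M (1, z)) :=
  M.contDiff.comp (contDiff_const.prodMk contDiff_id)

theorem contDiffAt_inv_fst_map {m : ℕ} {M : (ℝ × Euc m) →L[ℝ] (ℝ × Euc m)} {z : Euc m}
    (h : (M (1, z)).1 ≠ 0) : ContDiffAt ℝ ∞ (fun z => (M (1, z)).1⁻¹) z :=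
  (contDiff_map_one_prodMk M).fst.contDiffAt.inv h

theorem contDiffAt_projAction {m : ℕ} {M : (ℝ × Euc m) →L[ℝ] (ℝ × Euc m)} {z : Euc m}
    (h : (M (1, z)).1 ≠ 0) : ContDiffAt ℝ ∞ (projAction M) z :=
  (contDiffAt_inv_fst_map h).smul (contDiff_map_one_prodMk M).snd.contDiffAt

theorem one_projAction_eq_smul {m : ℕ} {M : (ℝ × Euc m) →L[ℝ] (ℝ × Euc m)} {z : Euc m}
    (h : (M (1, z)).1 ≠ 0) : ((1 : ℝ), projAction M z) = (M (1, z)).1⁻¹ • M (1, z) :=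
  Prod.ext (inv_mul_cancel₀ h).symm rfl

theorem one_sub_inner_projAction {m : ℕ} {M : (ℝ × Euc m) →L[ℝ] (ℝ × Euc m)}
    (hM : ∀ X Y, lorentzForm (M X) (M Y) = lorentzForm X Y) {x y : Euc m}
    (hx : (M (1, x)).1 ≠ 0) (hy : (M (1, y)).1 ≠ 0) :
    1 - ⟪projAction M x, projAction M y⟫ =
      (M (1, x)).1⁻¹ * (M (1, y)).1⁻¹ * (1 - ⟪x, y⟫) := by
  rw [one_sub_inner_eq_neg_lorentzForm, one_projAction_eq_smul hx, one_projAction_eq_smul hy,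
    lorentzForm_smul_smul, hM, one_sub_inner_eq_neg_lorentzForm, mul_neg]

theorem mixedForm_projAction {m : ℕ} {M : (ℝ × Euc m) →L[ℝ] (ℝ × Euc m)}
    (hM : ∀ X Y, lorentzForm (M X) (M Y) = lorentzForm X Y) {x y : Euc m}
    (hx : (M (1, x)).1 ≠ 0) (hy : (M (1, y)).1 ≠ 0) (hxy : 1 - ⟪x, y⟫ ≠ 0) (u v : Euc m) :
    mixedForm (projAction M x) (projAction M y) (fderiv ℝ (projAction M) x u)
      (fderiv ℝ (projAction M) y v) = mixedForm x y u v := by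
  have action_deriv {z : Euc m} (hz : (M (1, z)).1 ≠ 0) :
      HasFDerivAt (projAction M) (fderiv ℝ (projAction M) z) z :=
    ((contDiffAt_projAction hz).differentiableAt (by simp)).hasFDerivAt
  have eventually_ne {z : Euc m} (hz : (M (1, z)).1 ≠ 0) : ∀ᶠ z' in 𝓝 z, (M (1, z')).1 ≠ 0 :=
    (contDiff_map_one_prodMk M).fst.continuous.continuousAt.eventually_ne hz
  have kernel_eventually_ne : ∀ᶠ y' in 𝓝 y, 1 - ⟪x, y'⟫ ≠ 0 :=
    ContinuousAt.eventually_ne (by fun_prop) hxy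
  rw [mixedForm_eq_neg_mixedLogDeriv_of_eq_mul (L := fun x y => 1 - ⟪x, y⟫)
      (c := fun z => (M (1, z)).1⁻¹) (d := fun z => (M (1, z)).1⁻¹) (action_deriv hx)
      (action_deriv hy) ?_ ((contDiffAt_inv_fst_map hx).differentiableAt (by simp))
      (inv_ne_zero hx) ((eventually_ne hy).mono fun _ => inv_ne_zero) ?_]
  · exact (mixedForm_eq_neg_mixedLogDeriv (hasFDerivAt_id x) (hasFDerivAt_id y) hxy u v).symm
  · filter_upwards [eventually_ne hy] with y' hy'
    filter_upwards [eventually_ne hx] with x' hx'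
    exact one_sub_inner_projAction hM hx' hy'
  · filter_upwards [kernel_eventually_ne] with y' hy'
    exact ⟨(differentiableAt_id.inner ℝ (differentiableAt_const y')).const_sub 1, hy'⟩

namespace IsLorentzLift

variable {n : ℕ} {T : Sph n → Sph n} {M : (ℝ × Euc (n + 1)) →L[ℝ] (ℝ × Euc (n + 1))}

theorem map_fst_ne_zero (h : IsLorentzLift M T) (x : Sph n) :
    (M (1, (x : Euc (n + 1)))).1 ≠ 0 := by
  obtain ⟨c, hc, hx⟩ := h.exists_smul x
  simpa [hx] using hc

theorem coe_apply (h : IsLorentzLift M T) (x : Sph n) :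
    (T x : Euc (n + 1)) = projAction M x := by
  obtain ⟨c, hc, hx⟩ := h.exists_smul x
  simp [projAction, hx, hc]

theorem contMDiff (h : IsLorentzLift M T) : ContMDiff (𝓡 n) (𝓡 n) ∞ T := by
  refine contMDiff_sph_of_coe ?_
  simp_rw [h.coe_apply]
  intro x
  exact ContMDiffAt.comp (g := projAction M) x
    (contDiffAt_projAction (h.map_fst_ne_zero x)).contMDiffAt contMDiff_coe_sph.contMDiffAt

theorem apply_ne_apply (h : IsLorentzLift M T) {x y : Sph n} (hxy : x ≠ y) : T x ≠ T y := by
  have kernel_eq := one_sub_inner_projAction h.lorentzForm_map (h.map_fst_ne_zero x)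
    (h.map_fst_ne_zero y)
  rw [← h.coe_apply, ← h.coe_apply] at kernel_eq
  intro hT
  rw [hT, inner_self_sph, sub_self, eq_comm] at kernel_eq
  exact mul_ne_zero (mul_ne_zero (inv_ne_zero (h.map_fst_ne_zero x))
    (inv_ne_zero (h.map_fst_ne_zero y))) (one_sub_inner_pos hxy).ne' kernel_eq

theorem hasMFDerivAt_coe (h : IsLorentzLift M T) (x : Sph n) :
    HasMFDerivAt (𝓡 n) 𝓘(ℝ, Euc (n + 1)) (fun z => (T z : Euc (n + 1))) x
      ((fderiv ℝ (projAction M) x).comp (tangentInclusion x)) := by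
  have chain := HasMFDerivAt.comp x
    ((contDiffAt_projAction (h.map_fst_ne_zero x)).differentiableAt
      (by simp)).hasFDerivAt.hasMFDerivAt (hasMFDerivAt_coe_sph x)
  exact chain.congr_of_eventuallyEq (.of_forall h.coe_apply)

theorem pullback_omegaSphere (h : IsLorentzLift M T) {p : Sph n × Sph n}
    (hp : p ∈ distinctPairs (Sph n)) :
    pullback (pairModel n) (pairModel n) (Prod.map T T) (omegaSphere n) p = omegaSphere n p := by
  have T_diff (x : Sph n) : MDifferentiableAt (𝓡 n) (𝓡 n) T x :=
    h.contMDiff.mdifferentiableAt (by simp)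
  have mixed_eq (u v) := mixedForm_projAction h.lorentzForm_map (h.map_fst_ne_zero p.1)
    (h.map_fst_ne_zero p.2) (one_sub_inner_pos hp).ne' u v
  ext w
  refine (pullback_omegaSphere_prodMk_apply ((T_diff p.1).comp p mdifferentiableAt_fst)
    ((T_diff p.2).comp p mdifferentiableAt_snd)
    ((h.hasMFDerivAt_coe p.1).comp p (hasMFDerivAt_fst p))
    ((h.hasMFDerivAt_coe p.2).comp p (hasMFDerivAt_snd p)) (h.apply_ne_apply hp) w).trans ?_
  rw [omegaSphere_apply hp, ← mixed_eq, ← mixed_eq, ← h.coe_apply, ← h.coe_apply]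
  rfl

end IsLorentzLift

end Moebius

section InvStereo

variable {m : ℕ} {q : Euc m} {ρ : ℝ} {e : Fin 3 → Euc m}

/-- The coordinates, in the frame `(e₀, e₁, e₂)` and relative to the centre and the radius, of
the point whose stereographic image is `ζ`. -/
noncomputable def stereoCoord (ζ : ℂ) : Fin 3 → ℝ :=
  ![2 * ζ.re / (‖ζ‖ ^ 2 + 1), 2 * ζ.im / (‖ζ‖ ^ 2 + 1), (‖ζ‖ ^ 2 - 1) / (‖ζ‖ ^ 2 + 1)]

theorem invStereo_eq_add_smul_sum (q : Euc m) (ρ : ℝ) (e : Fin 3 → Euc m) (ζ : ℂ) :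
    invStereo q ρ e ζ = q + ρ • ∑ i, stereoCoord ζ i • e i := by
  simp only [invStereo, stereoCoord, Fin.sum_univ_three, Matrix.cons_val_zero,
    Matrix.cons_val_one, Matrix.cons_val]
  module

theorem normSq_add_one_ne_zero (ζ : ℂ) : Complex.normSq ζ + 1 ≠ 0 :=
  (add_pos_of_nonneg_of_pos (Complex.normSq_nonneg ζ) one_pos).ne'

theorem sum_stereoCoord_sq (ζ : ℂ) : ∑ i, stereoCoord ζ i ^ 2 = 1 := by
  have hζ := normSq_add_one_ne_zero ζ
  simp only [stereoCoord, Fin.sum_univ_three, Matrix.cons_val_zero, Matrix.cons_val_one,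
    Matrix.cons_val, Complex.sq_norm]
  field_simp
  rw [Complex.normSq_apply]
  ring

theorem sum_stereoCoord_sub_sq (X Y : ℂ) :
    ∑ i, (stereoCoord X i - stereoCoord Y i) ^ 2 =
      4 * Complex.normSq (X - Y) / ((‖X‖ ^ 2 + 1) * (‖Y‖ ^ 2 + 1)) := by
  have hX := normSq_add_one_ne_zero X
  have hY := normSq_add_one_ne_zero Y
  simp only [stereoCoord, Fin.sum_univ_three, Matrix.cons_val_zero, Matrix.cons_val_one,
    Matrix.cons_val, Complex.sq_norm]
  field_simp
  simp only [Complex.normSq_apply, Complex.sub_re, Complex.sub_im]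
  ring

theorem norm_invStereo_sub_sq (q : Euc m) (ρ : ℝ) (he : Orthonormal ℝ e) (X Y : ℂ) :
    ‖invStereo q ρ e X - invStereo q ρ e Y‖ ^ 2 =
      4 * ρ ^ 2 * Complex.normSq (X - Y) / ((‖X‖ ^ 2 + 1) * (‖Y‖ ^ 2 + 1)) := by
  have hsub : invStereo q ρ e X - invStereo q ρ e Y =
      ρ • ∑ i, (stereoCoord X i - stereoCoord Y i) • e i := by
    simp only [invStereo_eq_add_smul_sum, sub_smul, Finset.sum_sub_distrib]
    module
  rw [hsub, norm_smul, mul_pow, ← real_inner_self_eq_norm_sq (∑ i, _), he.inner_sum]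
  simp only [conj_trivial, ← pow_two, sum_stereoCoord_sub_sq, Real.norm_eq_abs, sq_abs]
  ring

theorem invStereo_injective (he : Orthonormal ℝ e) (hρ : ρ ≠ 0) :
    Function.Injective (invStereo q ρ e) := by
  intro X Y h
  have hnorm := norm_invStereo_sub_sq q ρ he X Y
  rw [h, sub_self, norm_zero, zero_pow two_ne_zero, eq_comm, div_eq_zero_iff] at hnorm
  have hXY := (mul_eq_zero.1 (hnorm.resolve_right (by positivity))).resolve_left (by positivity)
  exact sub_eq_zero.1 (Complex.normSq_eq_zero.1 hXY)

theorem contDiff_invStereo (q : Euc m) (ρ : ℝ) (e : Fin 3 → Euc m) :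
    ContDiff ℝ ∞ (invStereo q ρ e) := by
  have hre : ContDiff ℝ ∞ Complex.re := Complex.reCLM.contDiff
  have him : ContDiff ℝ ∞ Complex.im := Complex.imCLM.contDiff
  have hnorm : ContDiff ℝ ∞ fun ζ : ℂ => ‖ζ‖ ^ 2 := contDiff_norm_sq ℝ
  have hdiv : ContDiff ℝ ∞ fun ζ : ℂ => ρ / (‖ζ‖ ^ 2 + 1) :=
    contDiff_const.div (hnorm.add contDiff_const) fun ζ => by positivity
  unfold invStereo
  fun_prop

theorem hasFDerivAt_invStereo (q : Euc m) (ρ : ℝ) (e : Fin 3 → Euc m) (ζ : ℂ) :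
    HasFDerivAt (invStereo q ρ e) (fderiv ℝ (invStereo q ρ e) ζ) ζ :=
  ((contDiff_invStereo q ρ e).differentiable (by simp) ζ).hasFDerivAt

theorem one_sub_inner_eq_norm_sub_sq_div_two {E : Type*} [NormedAddCommGroup E]
    [InnerProductSpace ℝ E] {x y : E} (hx : ‖x‖ = 1) (hy : ‖y‖ = 1) :
    1 - ⟪x, y⟫ = ‖x - y‖ ^ 2 / 2 := by
  rw [norm_sub_sq_real, hx, hy]
  ring

theorem mixedForm_invStereo (he : Orthonormal ℝ e) (hρ : ρ ≠ 0)
    (hs : ∀ ζ, invStereo q ρ e ζ ∈ sphere (0 : Euc m) 1) {X Y : ℂ} (hXY : X ≠ Y) (a b : ℂ) :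
    mixedForm (invStereo q ρ e X) (invStereo q ρ e Y) (fderiv ℝ (invStereo q ρ e) X a)
      (fderiv ℝ (invStereo q ρ e) Y b) = -2 * (a * b / (X - Y) ^ 2).re := by
  have hkernel (X Y : ℂ) : 1 - ⟪invStereo q ρ e X, invStereo q ρ e Y⟫ =
      2 * ρ ^ 2 * (‖X‖ ^ 2 + 1)⁻¹ * (‖Y‖ ^ 2 + 1)⁻¹ * Complex.normSq (X - Y) := by
    rw [one_sub_inner_eq_norm_sub_sq_div_two (mem_sphere_zero_iff_norm.1 (hs X))
      (mem_sphere_zero_iff_norm.1 (hs Y)), norm_invStereo_sub_sq q ρ he]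
    field_simp
    ring
  have hfactor : Differentiable ℝ fun X : ℂ => 2 * ρ ^ 2 * (‖X‖ ^ 2 + 1)⁻¹ :=
    ((((contDiff_norm_sq ℝ (n := 1)).differentiable one_ne_zero).add_const _).inv
      fun X => by positivity).const_mul _
  have hnormSq (Y : ℂ) : Differentiable ℝ fun X : ℂ => Complex.normSq (X - Y) := by
    simp only [Complex.normSq_eq_norm_sq]
    exact ((contDiff_norm_sq ℝ (n := 1)).differentiable one_ne_zero).comp
      (differentiable_id.sub_const Y)
  rw [mixedForm_eq_neg_mixedLogDeriv_of_eq_mul (hasFDerivAt_invStereo q ρ e X)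
    (hasFDerivAt_invStereo q ρ e Y) (.of_forall fun Y => .of_forall fun X => hkernel X Y)
    (hfactor X) (by positivity) (.of_forall fun Y => by positivity)
    ((eventually_ne_nhds hXY.symm).mono fun Y hY =>
      ⟨hnormSq Y X, Complex.normSq_eq_zero.not.2 (sub_ne_zero.2 hY.symm)⟩),
    mixedLogDeriv_normSq_sub hXY]
  ring

end InvStereo

section CrossRatio

theorem pullback_prodMap_omegaSphere_apply {n : ℕ} {E : Type*} [NormedAddCommGroup E]
    [NormedSpace ℝ E] {f : E → Sph n} (hf : ContDiff ℝ 1 fun z => (f z : Euc (n + 1))) {p : E × E}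
    (hp : f p.1 ≠ f p.2) (w : Fin 2 → E × E) :
    pullback 𝓘(ℝ, E × E) (pairModel n) (Prod.map f f) (omegaSphere n) p w =
      mixedForm (f p.1 : Euc (n + 1)) (f p.2)
        (fderiv ℝ (fun z => (f z : Euc (n + 1))) p.1 (w 0).1)
        (fderiv ℝ (fun z => (f z : Euc (n + 1))) p.2 (w 1).2) -
      mixedForm (f p.1 : Euc (n + 1)) (f p.2)
        (fderiv ℝ (fun z => (f z : Euc (n + 1))) p.1 (w 1).1)
        (fderiv ℝ (fun z => (f z : Euc (n + 1))) p.2 (w 0).2) := by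
  have f_diff : MDifferentiable 𝓘(ℝ, E) (𝓡 n) f :=
    (contMDiff_sph_of_coe hf.contMDiff).mdifferentiable one_ne_zero
  have coe_deriv (z : E) := (hf.differentiable one_ne_zero z).hasFDerivAt
  exact pullback_omegaSphere_prodMk_apply
    ((f_diff p.1).comp p differentiableAt_fst.mdifferentiableAt)
    ((f_diff p.2).comp p differentiableAt_snd.mdifferentiableAt)
    ((coe_deriv p.1).comp p hasFDerivAt_fst).hasMFDerivAt
    ((coe_deriv p.2).comp p hasFDerivAt_snd).hasMFDerivAt hp w

theorem rePart_crossRatioForm_apply (p : ℂ × ℂ) (w : Fin 2 → ℂ × ℂ) :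
    rePart (crossRatioForm p) w = ((w 0).1 * (w 1).2 / (p.1 - p.2) ^ 2).re -
      ((w 1).1 * (w 0).2 / (p.1 - p.2) ^ 2).re := by
  rw [← Complex.sub_re, ← sub_div, div_eq_inv_mul, ← one_div]
  rfl

theorem rePart_crossRatioForm {σ : ℂ → Sph 2} (hσ : IsInvStereo σ) {p : ℂ × ℂ}
    (hp : p ∈ distinctPairs ℂ) :
    rePart (crossRatioForm p) =
      (-(1 / 2) : ℝ) • pullback 𝓘(ℝ, ℂ × ℂ) (pairModel 2) (Prod.map σ σ) (omegaSphere 2) p := by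
  obtain ⟨e, he, hσe⟩ := hσ
  have coe_σ : (fun ζ => (σ ζ : Euc 3)) = invStereo 0 1 e := funext hσe
  have mem_sphere (ζ : ℂ) : invStereo 0 1 e ζ ∈ sphere (0 : Euc 3) 1 := hσe ζ ▸ (σ ζ).2
  have σ_ne : σ p.1 ≠ σ p.2 := fun h =>
    hp (invStereo_injective he one_ne_zero (by rw [← hσe, ← hσe, h]))
  ext w
  have pullback_apply := pullback_prodMap_omegaSphere_apply
    (coe_σ ▸ (contDiff_invStereo 0 1 e).of_le (by simp)) σ_ne w
  rw [coe_σ, hσe, hσe, mixedForm_invStereo he one_ne_zero mem_sphere hp,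
    mixedForm_invStereo he one_ne_zero mem_sphere hp] at pullback_apply
  refine (rePart_crossRatioForm_apply p w).trans
    (Eq.trans ?_ (congrArg (-(1 / 2) * ·) pullback_apply).symm)
  ring

end CrossRatio

section Uniqueness

/-- The difference quotients of `f` along `a` have norm `k (x + t a) ‖a‖`. -/
theorem norm_apply_eq_of_norm_sub_eq_mul {E F : Type*} [NormedAddCommGroup E] [NormedSpace ℝ E]
    [NormedAddCommGroup F] [NormedSpace ℝ F] {f : E → F} {f' : E →L[ℝ] F} {k : E → ℝ} {x : E}
    (hf : HasFDerivAt f f' x) (hk : ContinuousAt k x)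
    (h : ∀ y, ‖f y - f x‖ = k y * ‖y - x‖) (a : E) : ‖f' a‖ = k x * ‖a‖ := by
  have slope_norm : Tendsto (fun t : ℝ => ‖t⁻¹ • (f (x + t • a) - f x)‖) (𝓝[≠] 0) (𝓝 ‖f' a‖) :=
    (hf.hasLineDerivAt a).tendsto_slope_zero.norm
  have path : Tendsto (fun t : ℝ => x + t • a) (𝓝[≠] 0) (𝓝 x) := by
    refine Tendsto.mono_left ?_ nhdsWithin_le_nhds
    simpa using (by fun_prop : Continuous fun t : ℝ => x + t • a).tendsto 0
  refine tendsto_nhds_unique slope_norm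
    (((hk.tendsto.comp path).mul_const ‖a‖).congr' ?_)
  filter_upwards [self_mem_nhdsWithin] with t ht
  have ht' : ‖t‖ ≠ 0 := norm_ne_zero_iff.2 ht
  rw [norm_smul, h, add_sub_cancel_left, norm_smul, norm_inv, Function.comp_apply]
  field_simp

theorem norm_fderiv_invStereo_apply {m : ℕ} (q : Euc m) {ρ : ℝ} {e : Fin 3 → Euc m}
    (he : Orthonormal ℝ e) (ζ a : ℂ) :
    ‖fderiv ℝ (invStereo q ρ e) ζ a‖ = 2 * |ρ| / (‖ζ‖ ^ 2 + 1) * ‖a‖ := by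
  have factor_cont : Continuous fun z : ℂ => 2 * |ρ| / √((‖z‖ ^ 2 + 1) * (‖ζ‖ ^ 2 + 1)) :=
    continuous_const.div (by fun_prop) fun z => by positivity
  rw [norm_apply_eq_of_norm_sub_eq_mul (hasFDerivAt_invStereo q ρ e ζ) factor_cont.continuousAt
    (fun z => ?_) a, Real.sqrt_mul_self (by positivity)]
  rw [← sq_eq_sq₀ (norm_nonneg _) (by positivity), norm_invStereo_sub_sq q ρ he, mul_pow, div_pow,
    Real.sq_sqrt (by positivity), mul_pow, sq_abs, Complex.sq_norm (z - ζ)]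
  ring

variable {x y u v : Euc 4} {c c' : ℂ}

namespace IsInfinitesimalCrossRatio

theorem im_nonneg (h : IsInfinitesimalCrossRatio x y u v c) : 0 ≤ c.im := by
  obtain ⟨q, ρ, e, -, -, -, X, Y, a, b, -, -, -, -, -, him⟩ := h
  exact him

theorem re_eq (h : IsInfinitesimalCrossRatio x y u v c) (hxy : x ≠ y) :
    c.re = -(1 / 2) * mixedForm x y u v := by
  obtain ⟨q, ρ, e, hρ, he, hs, X, Y, a, b, rfl, rfl, rfl, rfl, rfl, -⟩ := h
  rw [mixedForm_invStereo he hρ.ne' hs fun h => hxy (congrArg _ h)]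
  ring

theorem norm_eq (h : IsInfinitesimalCrossRatio x y u v c) : ‖c‖ = ‖u‖ * ‖v‖ / ‖x - y‖ ^ 2 := by
  obtain ⟨q, ρ, e, hρ, he, -, X, Y, a, b, rfl, rfl, rfl, rfl, rfl, -⟩ := h
  rw [norm_invStereo_sub_sq q ρ he, norm_fderiv_invStereo_apply q he,
    norm_fderiv_invStereo_apply q he, Complex.normSq_eq_norm_sq, abs_of_pos hρ, norm_div, norm_mul,
    norm_pow]
  field_simp
  ring

theorem unique (h : IsInfinitesimalCrossRatio x y u v c)
    (h' : IsInfinitesimalCrossRatio x y u v c') (hxy : x ≠ y) : c = c' := by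
  have re_eq : c.re = c'.re := (h.re_eq hxy).trans (h'.re_eq hxy).symm
  have normSq_eq : Complex.normSq c = Complex.normSq c' := by
    rw [Complex.normSq_eq_norm_sq, Complex.normSq_eq_norm_sq, h.norm_eq, h'.norm_eq]
  rw [Complex.normSq_apply, Complex.normSq_apply, re_eq, add_right_inj] at normSq_eq
  exact Complex.ext re_eq ((mul_self_inj h.im_nonneg h'.im_nonneg).1 normSq_eq)

end IsInfinitesimalCrossRatio

end Uniqueness

section Existence

theorem mem_orthogonal_span_range_iff {ι E : Type*} [NormedAddCommGroup E] [InnerProductSpace ℝ E]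
    {v : ι → E} {w : E} : w ∈ (Submodule.span ℝ (range v))ᗮ ↔ ∀ i, ⟪v i, w⟫ = 0 := by
  rw [← Submodule.span_singleton_le_iff_mem, ← Submodule.isOrtho_iff_le, Submodule.isOrtho_span]
  simp [real_inner_comm w]

theorem exists_norm_eq_one_forall_inner_eq_zero {ι E : Type*} [Fintype ι] [NormedAddCommGroup E]
    [InnerProductSpace ℝ E] [FiniteDimensional ℝ E] (v : ι → E)
    (hι : Fintype.card ι < Module.finrank ℝ E) : ∃ w : E, ‖w‖ = 1 ∧ ∀ i, ⟪v i, w⟫ = 0 := by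
  have finrank_pos : 0 < Module.finrank ℝ (Submodule.span ℝ (range v))ᗮ := by
    have := (Submodule.span ℝ (range v)).finrank_add_finrank_orthogonal
    have := finrank_range_le_card (R := ℝ) v
    rw [Set.finrank] at this
    lia
  have := Module.finrank_pos_iff.1 finrank_pos
  obtain ⟨w, hw⟩ := exists_norm_eq (Submodule.span ℝ (range v))ᗮ zero_le_one
  exact ⟨w, hw, mem_orthogonal_span_range_iff.1 w.2⟩

/-- The three-space `⟪b 3, ·⟫ = const` cuts out a sphere through `x` and `y` that is tangent to `u`
and `v`; its pole in the direction `b 2` has `x` and `y` on the equator. -/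
theorem exists_orthonormalBasis_of_tangents (x y u v : Euc 4) :
    ∃ b : OrthonormalBasis (Fin 4) ℝ (Euc 4), ⟪b 2, x⟫ = 0 ∧ ⟪b 2, y⟫ = 0 ∧
      ⟪b 3, x⟫ = ⟪b 3, y⟫ ∧ ⟪b 3, u⟫ = 0 ∧ ⟪b 3, v⟫ = 0 := by
  obtain ⟨normal, normal_norm, normal_inner⟩ :=
    exists_norm_eq_one_forall_inner_eq_zero ![x - y, u, v] (by simp)
  obtain ⟨pole, pole_norm, pole_inner⟩ :=
    exists_norm_eq_one_forall_inner_eq_zero ![x, y, normal] (by simp)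
  simp only [Fin.forall_fin_succ, Matrix.cons_val_zero, Matrix.cons_val_succ, IsEmpty.forall_iff,
    and_true, inner_sub_left, sub_eq_zero] at normal_inner pole_inner
  have pole_normal : Orthonormal ℝ (({2, 3} : Set (Fin 4)).domRestrict ![0, 0, pole, normal]) := by
    rw [orthonormal_iff_ite]
    rintro ⟨i, rfl | rfl⟩ ⟨j, rfl | rfl⟩ <;>
      simp [normal_norm, pole_norm, pole_inner, real_inner_comm normal pole, Subtype.ext_iff]
  obtain ⟨b, hb⟩ := pole_normal.exists_orthonormalBasis_extension_of_card_eq (by simp)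
  have b_two : b 2 = pole := hb 2 (by simp)
  have b_three : b 3 = normal := hb 3 (by simp)
  refine ⟨b, ?_⟩
  rw [b_two, b_three]
  simpa only [real_inner_comm _ pole, real_inner_comm _ normal, pole_inner, true_and]
    using normal_inner

theorem inner_sq_lt_one_of_inner_eq {E : Type*} [NormedAddCommGroup E] [InnerProductSpace ℝ E]
    {w x y : E} (hw : ‖w‖ = 1) (hx : ‖x‖ = 1) (hy : ‖y‖ = 1) (h : ⟪w, x⟫ = ⟪w, y⟫) (hxy : x ≠ y) :
    ⟪w, x⟫ ^ 2 < 1 := by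
  have norm_sub_sq {z : E} (hz : ‖z‖ = 1) : ‖z - ⟪w, z⟫ • w‖ ^ 2 = 1 - ⟪w, z⟫ ^ 2 := by
    rw [norm_sub_sq_real, inner_smul_right, real_inner_comm, norm_smul, hw, hz, mul_one,
      Real.norm_eq_abs, sq_abs]
    ring
  by_contra! one_le
  have eq_smul {z : E} (hz : ‖z‖ = 1) (hzx : ⟪w, z⟫ = ⟪w, x⟫) : z = ⟪w, x⟫ • w := by
    have := norm_sub_sq hz
    rw [hzx] at this
    exact sub_eq_zero.1 (norm_eq_zero.1 (by nlinarith [sq_nonneg ‖z - ⟪w, x⟫ • w‖]))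
  exact hxy ((eq_smul hx rfl).trans (eq_smul hy h.symm).symm)

theorem inner_fderiv_eq_zero_of_norm_eq {E V : Type*} [NormedAddCommGroup E] [NormedSpace ℝ E]
    [NormedAddCommGroup V] [InnerProductSpace ℝ V] {f : E → V} {f' : E →L[ℝ] V} {z : E} {r : ℝ}
    (hf : HasFDerivAt f f' z) (h : ∀ z, ‖f z‖ = r) (a : E) : ⟪f z, f' a⟫ = 0 := by
  have norm_sq_deriv := hf.norm_sq
  simp only [h] at norm_sq_deriv
  simpa using DFunLike.congr_fun (norm_sq_deriv.unique (hasFDerivAt_const (r ^ 2) z)) a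

/-- The stereographic parametrization of the two-sphere in which the unit sphere of `ℝ^4` meets the
hyperplane `⟪b 3, ·⟫ = t`, with pole in the direction `b 2`. -/
noncomputable def sectionStereo (b : OrthonormalBasis (Fin 4) ℝ (Euc 4)) (t : ℝ) : ℂ → Euc 4 :=
  invStereo (t • b 3) √(1 - t ^ 2) (b ∘ Fin.castSucc)

variable {b : OrthonormalBasis (Fin 4) ℝ (Euc 4)} {t : ℝ} {x u : Euc 4}

theorem orthonormal_comp_castSucc (b : OrthonormalBasis (Fin 4) ℝ (Euc 4)) :
    Orthonormal ℝ (b ∘ Fin.castSucc) :=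
  b.orthonormal.comp _ (Fin.castSucc_injective 3)

theorem sectionStereo_eq_sum (b : OrthonormalBasis (Fin 4) ℝ (Euc 4)) (t : ℝ) (ζ : ℂ) :
    sectionStereo b t ζ =
      ∑ i, (Fin.snoc (fun i => √(1 - t ^ 2) * stereoCoord ζ i) t : Fin 4 → ℝ) i • b i := by
  rw [Fin.sum_univ_castSucc, sectionStereo, invStereo_eq_add_smul_sum, add_comm, Finset.smul_sum]
  simp only [Fin.snoc_castSucc, Fin.snoc_last, smul_smul, Function.comp_apply]
  rfl

theorem norm_sectionStereo (ht : t ^ 2 ≤ 1) (ζ : ℂ) : ‖sectionStereo b t ζ‖ = 1 := by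
  rw [← sq_eq_sq₀ (norm_nonneg _) zero_le_one, ← real_inner_self_eq_norm_sq,
    sectionStereo_eq_sum, b.orthonormal.inner_sum, Fin.sum_univ_castSucc]
  simp only [Fin.snoc_castSucc, Fin.snoc_last, conj_trivial, ← pow_two, mul_pow, ← Finset.mul_sum,
    sum_stereoCoord_sq, Real.sq_sqrt (sub_nonneg.2 ht)]
  ring

theorem inner_sectionStereo (b : OrthonormalBasis (Fin 4) ℝ (Euc 4)) (t : ℝ) (ζ : ℂ) :
    ⟪b 3, sectionStereo b t ζ⟫ = t := by
  rw [sectionStereo_eq_sum, b.orthonormal.inner_right_fintype]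
  exact Fin.snoc_last _ _

theorem exists_sectionStereo_eq (ht : t ^ 2 < 1) (hx : ‖x‖ = 1) (hx2 : ⟪b 2, x⟫ = 0)
    (hx3 : ⟪b 3, x⟫ = t) : ∃ X, sectionStereo b t X = x := by
  have radius_pos : 0 < √(1 - t ^ 2) := Real.sqrt_pos.2 (sub_pos.2 ht)
  have radius_sq : √(1 - t ^ 2) ^ 2 = 1 - t ^ 2 := Real.sq_sqrt (sub_pos.2 ht).le
  have coords_sq : ⟪b 0, x⟫ ^ 2 + ⟪b 1, x⟫ ^ 2 = 1 - t ^ 2 := by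
    have := b.sum_sq_norm_inner_right x
    simp only [Fin.sum_univ_four, Real.norm_eq_abs, sq_abs, hx, hx2, hx3] at this
    linarith
  let X : ℂ := ⟨⟪b 0, x⟫ / √(1 - t ^ 2), ⟪b 1, x⟫ / √(1 - t ^ 2)⟩
  have X_norm : ‖X‖ ^ 2 = 1 := by
    rw [Complex.sq_norm, Complex.normSq_mk, ← pow_two, ← pow_two, div_pow, div_pow, ← add_div,
      coords_sq, radius_sq, div_self (sub_pos.2 ht).ne']
  refine ⟨X, ?_⟩
  rw [← b.sum_repr' x, sectionStereo, invStereo, X_norm, Fin.sum_univ_four, hx2, hx3]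
  simp only [X, Function.comp_apply, Fin.castSucc_zero, Fin.castSucc_one]
  match_scalars <;> field_simp <;> ring

theorem finrank_span_pair_eq_two (ht : t ^ 2 < 1) (X : ℂ) :
    Module.finrank ℝ (Submodule.span ℝ (range ![b 3, sectionStereo b t X])) = 2 := by
  have independent : LinearIndependent ℝ ![b 3, sectionStereo b t X] := by
    refine (LinearIndependent.pair_iff' (b.orthonormal.ne_zero 3)).2 fun s hs => ?_
    have hst : s = t := by
      rw [← inner_sectionStereo b t X, ← hs, inner_smul_right, real_inner_self_eq_norm_sq,
        b.norm_eq_one]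
      ring
    have hs1 : |s| = 1 := by
      rw [← norm_sectionStereo (b := b) ht.le X, ← hs, norm_smul, b.norm_eq_one, mul_one,
        Real.norm_eq_abs]
    rw [← hst, ← sq_abs, hs1] at ht
    norm_num at ht
  simpa using finrank_span_eq_card independent

theorem fderiv_sectionStereo_injective (ht : t ^ 2 < 1) (X : ℂ) :
    Function.Injective (fderiv ℝ (sectionStereo b t) X) := by
  refine (injective_iff_map_eq_zero _).2 fun a ha => ?_
  have scale_ne_zero : 2 * |√(1 - t ^ 2)| / (‖X‖ ^ 2 + 1) ≠ 0 := by
    have := Real.sqrt_pos.2 (sub_pos.2 ht)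
    positivity
  have norm_eq := norm_fderiv_invStereo_apply (t • b 3) (ρ := √(1 - t ^ 2))
    (orthonormal_comp_castSucc b) X a
  exact norm_eq_zero.1
    ((mul_eq_zero.1 (norm_eq.symm.trans (norm_eq_zero.2 ha))).resolve_left scale_ne_zero)

theorem range_fderiv_sectionStereo (ht : t ^ 2 < 1) (X : ℂ) :
    (fderiv ℝ (sectionStereo b t) X).range =
      (Submodule.span ℝ (range ![b 3, sectionStereo b t X]))ᗮ := by
  have hderiv : HasFDerivAt (sectionStereo b t) (fderiv ℝ (sectionStereo b t) X) X :=
    hasFDerivAt_invStereo _ _ _ X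
  have normal_inner (a : ℂ) : ⟪b 3, fderiv ℝ (sectionStereo b t) X a⟫ = 0 := by
    have inner_deriv := (innerSL ℝ (b 3)).hasFDerivAt.comp X hderiv
    rw [show innerSL ℝ (b 3) ∘ sectionStereo b t = fun _ => t from
      funext fun ζ => inner_sectionStereo b t ζ] at inner_deriv
    exact DFunLike.congr_fun (inner_deriv.unique (hasFDerivAt_const t X)) a
  refine Submodule.eq_of_le_of_finrank_le ?_ ?_
  · rintro _ ⟨a, rfl⟩
    exact mem_orthogonal_span_range_iff.2 (Fin.forall_fin_two.2
      ⟨normal_inner a, inner_fderiv_eq_zero_of_norm_eq hderiv (norm_sectionStereo ht.le) a⟩)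
  · have span_finrank := finrank_span_pair_eq_two (b := b) ht X
    have finrank_add := Submodule.finrank_add_finrank_orthogonal
      (Submodule.span ℝ (range ![b 3, sectionStereo b t X]))
    rw [finrank_euclideanSpace_fin] at finrank_add
    have range_finrank := LinearMap.finrank_range_of_inj
      (f := (fderiv ℝ (sectionStereo b t) X).toLinearMap) (fderiv_sectionStereo_injective ht X)
    rw [Complex.finrank_real_complex] at range_finrank
    linarith

theorem exists_fderiv_sectionStereo_eq (ht : t ^ 2 < 1) {X : ℂ} (hu3 : ⟪b 3, u⟫ = 0)
    (hu : ⟪sectionStereo b t X, u⟫ = 0) : ∃ a, fderiv ℝ (sectionStereo b t) X a = u := by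
  change u ∈ (fderiv ℝ (sectionStereo b t) X).range
  rw [range_fderiv_sectionStereo ht]
  exact mem_orthogonal_span_range_iff.2 (Fin.forall_fin_two.2 ⟨hu3, hu⟩)

theorem orthonormal_neg_one {E : Type*} [NormedAddCommGroup E] [InnerProductSpace ℝ E]
    {e : Fin 3 → E} (he : Orthonormal ℝ e) : Orthonormal ℝ ![e 0, -e 1, e 2] := by
  rw [orthonormal_iff_ite] at he ⊢
  intro i j
  have h := he i j
  fin_cases i <;> fin_cases j <;> simpa using h

theorem invStereo_neg_one_comp_conj {m : ℕ} (q : Euc m) (ρ : ℝ) (e : Fin 3 → Euc m) :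
    invStereo q ρ ![e 0, -e 1, e 2] ∘ Complex.conjCLE = invStereo q ρ e := by
  ext1 ζ
  simp [invStereo]

theorem fderiv_invStereo_neg_one_conj {m : ℕ} (q : Euc m) (ρ : ℝ) (e : Fin 3 → Euc m) (ζ a : ℂ) :
    fderiv ℝ (invStereo q ρ ![e 0, -e 1, e 2]) (Complex.conjCLE ζ) (Complex.conjCLE a) =
      fderiv ℝ (invStereo q ρ e) ζ a := by
  rw [← invStereo_neg_one_comp_conj q ρ e, Complex.conjCLE.comp_right_fderiv]
  rfl

/-- If the given orientation makes the imaginary part negative, flip the sign of `e 1`. -/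
theorem exists_isInfinitesimalCrossRatio_of_invStereo {q : Euc 4} {ρ : ℝ} {e : Fin 3 → Euc 4}
    (hρ : 0 < ρ) (he : Orthonormal ℝ e) (hs : ∀ ζ, invStereo q ρ e ζ ∈ sphere (0 : Euc 4) 1)
    (X Y a b : ℂ) :
    ∃ c, IsInfinitesimalCrossRatio (invStereo q ρ e X) (invStereo q ρ e Y)
      (fderiv ℝ (invStereo q ρ e) X a) (fderiv ℝ (invStereo q ρ e) Y b) c := by
  rcases le_total 0 (a * b / (X - Y) ^ 2).im with him | him
  · exact ⟨_, q, ρ, e, hρ, he, hs, X, Y, a, b, rfl, rfl, rfl, rfl, rfl, him⟩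
  · have conj_eq (ζ : ℂ) : invStereo q ρ ![e 0, -e 1, e 2] (Complex.conjCLE ζ) =
        invStereo q ρ e ζ := congrFun (invStereo_neg_one_comp_conj q ρ e) ζ
    refine ⟨_, q, ρ, ![e 0, -e 1, e 2], hρ, orthonormal_neg_one he, fun ζ => ?_,
      Complex.conjCLE X, Complex.conjCLE Y, Complex.conjCLE a, Complex.conjCLE b,
      conj_eq X, conj_eq Y, fderiv_invStereo_neg_one_conj q ρ e X a,
      fderiv_invStereo_neg_one_conj q ρ e Y b, rfl, ?_⟩
    · rw [← Complex.conjCLE.apply_symm_apply ζ, conj_eq]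
      exact hs _
    · simp only [Complex.conjCLE_apply]
      rw [← map_mul, ← map_sub, ← map_pow, ← map_div₀, Complex.conj_im]
      exact neg_nonneg.2 him

theorem existsUnique_isInfinitesimalCrossRatio {x y u v : Euc 4} (hx : ‖x‖ = 1) (hy : ‖y‖ = 1)
    (hxy : x ≠ y) (hu : ⟪x, u⟫ = 0) (hv : ⟪y, v⟫ = 0) :
    ∃! c, IsInfinitesimalCrossRatio x y u v c := by
  refine existsUnique_of_exists_of_unique ?_ fun c c' hc hc' => hc.unique hc' hxy
  obtain ⟨b, hx2, hy2, hxy3, hu3, hv3⟩ := exists_orthonormalBasis_of_tangents x y u v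
  have ht := inner_sq_lt_one_of_inner_eq (b.norm_eq_one 3) hx hy hxy3 hxy
  obtain ⟨t, hx3⟩ : ∃ t, ⟪b 3, x⟫ = t := ⟨_, rfl⟩
  rw [hx3] at ht hxy3
  obtain ⟨X, rfl⟩ := exists_sectionStereo_eq ht hx hx2 hx3
  obtain ⟨Y, rfl⟩ := exists_sectionStereo_eq ht hy hy2 hxy3.symm
  obtain ⟨α, rfl⟩ := exists_fderiv_sectionStereo_eq ht hu3 hu
  obtain ⟨β, rfl⟩ := exists_fderiv_sectionStereo_eq ht hv3 hv
  exact exists_isInfinitesimalCrossRatio_of_invStereo (Real.sqrt_pos.2 (sub_pos.2 ht))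
    (orthonormal_comp_castSucc b)
    (fun ζ => mem_sphere_zero_iff_norm.2 (norm_sectionStereo ht.le ζ)) X Y α β

end Existence

section Primitive

variable {V : Type*} [NormedAddCommGroup V] [InnerProductSpace ℝ V] {g : ℝ → V} {p : ℝ × ℝ}

/-- The function `-½ ∂/∂s log (1 - ⟪g s, g t⟫)` of `p = (s, t)`, the coefficient of `ds` in a
primitive of `Re Ω_K`. -/
noncomputable def knotPotential (g : ℝ → V) (p : ℝ × ℝ) : ℝ :=
  1 / 2 * (⟪deriv g p.1, g p.2⟫ / (1 - ⟪g p.1, g p.2⟫))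

/-- The one-form `-½ ∂/∂s log (1 - ⟪g s, g t⟫) ds`, a primitive of `Re Ω_K` off the diagonal. -/
noncomputable def knotPrimitive (g : ℝ → V) (p : ℝ × ℝ) : (ℝ × ℝ) [⋀^Fin 1]→L[ℝ] ℝ :=
  knotPotential g p • ContinuousAlternatingMap.ofSubsingleton ℝ (ℝ × ℝ) ℝ (0 : Fin 1)
    (ContinuousLinearMap.fst ℝ ℝ ℝ)

theorem contDiffAt_knotPotential {k : ℕ∞ω} (hg : ContDiff ℝ k g) (hg' : ContDiff ℝ k (deriv g))
    (hp : 1 - ⟪g p.1, g p.2⟫ ≠ 0) : ContDiffAt ℝ k (knotPotential g) p :=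
  contDiffAt_const.mul <|
    ((hg'.comp contDiff_fst).inner ℝ (hg.comp contDiff_snd)).contDiffAt.div
      (contDiff_const.sub ((hg.comp contDiff_fst).inner ℝ (hg.comp contDiff_snd))).contDiffAt hp

theorem contDiffAt_knotPrimitive {k : ℕ∞ω} (hg : ContDiff ℝ k g) (hg' : ContDiff ℝ k (deriv g))
    (hp : 1 - ⟪g p.1, g p.2⟫ ≠ 0) : ContDiffAt ℝ k (knotPrimitive g) p :=
  (contDiffAt_knotPotential hg hg' hp).smul contDiffAt_const

theorem fderiv_knotPotential_snd (hg : Differentiable ℝ g) (hp : 1 - ⟪g p.1, g p.2⟫ ≠ 0)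
    (hd : DifferentiableAt ℝ (knotPotential g) p) :
    fderiv ℝ (knotPotential g) p (0, 1) =
      1 / 2 * mixedForm (g p.1) (g p.2) (deriv g p.1) (deriv g p.2) := by
  have along_snd : HasFDerivAt (fun t => knotPotential g (p.1, t))
      ((fderiv ℝ (knotPotential g) p).comp (ContinuousLinearMap.inr ℝ ℝ ℝ)) p.2 :=
    HasFDerivAt.comp (f := (p.1, ·)) p.2 hd.hasFDerivAt (hasFDerivAt_prodMk_right p.1 p.2)
  calc fderiv ℝ (knotPotential g) p (0, 1)
      = fderiv ℝ ((1 / 2 : ℝ) • fun t => ⟪deriv g p.1, g t⟫ / (1 - ⟪g p.1, g t⟫)) p.2 1 :=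
        (DFunLike.congr_fun along_snd.fderiv 1).symm
    _ = 1 / 2 * fderiv ℝ (fun t => ⟪deriv g p.1, g t⟫ / (1 - ⟪g p.1, g t⟫)) p.2 1 := by
      rw [fderiv_const_smul_field, Pi.smul_apply, smul_apply, smul_eq_mul]
    _ = 1 / 2 * mixedForm (g p.1) (g p.2) (deriv g p.1) (deriv g p.2) := by
      rw [fderiv_inner_div_one_sub_inner (hg p.2).hasFDerivAt hp, fderiv_apply_one_eq_deriv]

theorem fderiv_knotPrimitive_apply (hd : DifferentiableAt ℝ (knotPotential g) p) (z : ℝ × ℝ)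
    (v : Fin 1 → ℝ × ℝ) :
    fderiv ℝ (fun q => knotPrimitive g q v) p z = fderiv ℝ (knotPotential g) p z * (v 0).1 := by
  change fderiv ℝ (fun q => knotPotential g q * (v 0).1) p z = _
  rw [fderiv_mul_const hd, smul_apply, smul_eq_mul, mul_comm]

theorem extDeriv_knotPrimitive (hg : Differentiable ℝ g) (hp : 1 - ⟪g p.1, g p.2⟫ ≠ 0)
    (hd : DifferentiableAt ℝ (knotPotential g) p) (w : Fin 2 → ℝ × ℝ) :
    extDeriv (knotPrimitive g) p w =
      -(1 / 2) * mixedForm (g p.1) (g p.2) (deriv g p.1) (deriv g p.2) *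
        ((w 0).1 * (w 1).2 - (w 1).1 * (w 0).2) := by
  have eq_add_partial (z : ℝ × ℝ) : fderiv ℝ (knotPotential g) p z =
      z.1 * fderiv ℝ (knotPotential g) p (1, 0) + z.2 * fderiv ℝ (knotPotential g) p (0, 1) := by
    rw [← smul_eq_mul, ← smul_eq_mul, ← map_smul, ← map_smul, ← map_add]
    simp
  have primitive_diff : DifferentiableAt ℝ (knotPrimitive g) p := hd.smul_const _
  rw [extDeriv_apply primitive_diff, Fin.sum_univ_two, fderiv_knotPrimitive_apply hd,
    fderiv_knotPrimitive_apply hd, eq_add_partial, eq_add_partial (w 1),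
    fderiv_knotPotential_snd hg hp hd]
  simp [Fin.removeNth]
  ring

theorem knotPrimitive_add_intCast (hg : Function.Periodic g 1) (p : ℝ × ℝ) (k l : ℤ) :
    knotPrimitive g (p.1 + k, p.2 + l) = knotPrimitive g p := by
  have add_intCast {f : ℝ → V} (hf : Function.Periodic f 1) (t : ℝ) (m : ℤ) : f (t + m) = f t := by
    simpa only [mul_one] using hf.int_mul m t
  have deriv_periodic : Function.Periodic (deriv g) 1 := fun t => by
    rw [← deriv_comp_add_const, hg.funext]
  simp only [knotPrimitive, knotPotential, add_intCast hg, add_intCast deriv_periodic]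

end Primitive

section Knot

variable {γ : ℝ → Sph 3} {p : ℝ × ℝ}

theorem existsUnique_isKnotCrossRatio (hγ : Differentiable ℝ fun t => (γ t : Euc 4))
    (hp : p ∈ knotPairs γ) : ∃! c : ℂ, IsKnotCrossRatio γ p c := by
  have inner_deriv (t : ℝ) : ⟪(γ t : Euc 4), deriv (fun s => (γ s : Euc 4)) t⟫ = 0 :=
    inner_fderiv_eq_zero_of_norm_eq (hγ t).hasFDerivAt (fun s => norm_eq_of_mem_sphere (γ s)) 1
  exact existsUnique_isInfinitesimalCrossRatio (norm_eq_of_mem_sphere _) (norm_eq_of_mem_sphere _)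
    (Subtype.coe_ne_coe.2 hp) (inner_deriv _) (inner_deriv _)

theorem rePart_knotCrossRatio_apply (hγ : Differentiable ℝ fun t => (γ t : Euc 4))
    (hp : p ∈ knotPairs γ) (w : Fin 2 → ℝ × ℝ) :
    rePart (knotCrossRatio γ p) w =
      -(1 / 2) * mixedForm (γ p.1 : Euc 4) (γ p.2)
        (deriv (fun s => (γ s : Euc 4)) p.1) (deriv (fun s => (γ s : Euc 4)) p.2) *
        ((w 0).1 * (w 1).2 - (w 1).1 * (w 0).2) := by
  have isKnotCrossRatio : IsKnotCrossRatio γ p (Classical.epsilon (IsKnotCrossRatio γ p)) :=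
    Classical.epsilon_spec (existsUnique_isKnotCrossRatio hγ hp).exists
  rw [← isKnotCrossRatio.re_eq (Subtype.coe_ne_coe.2 hp), ← Complex.re_mul_ofReal]
  push_cast
  rfl

theorem rePart_knotCrossRatio (hγ : ContDiff ℝ 1 fun t => (γ t : Euc 4))
    (hp : p ∈ knotPairs γ) :
    rePart (knotCrossRatio γ p) = (-(1 / 2) : ℝ) •
      pullback 𝓘(ℝ, ℝ × ℝ) (pairModel 3) (Prod.map γ γ) (omegaSphere 3) p := by
  ext w
  have pullback_apply := pullback_prodMap_omegaSphere_apply hγ hp w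
  simp only [fderiv_eq_smul_deriv, mixedForm_smul_smul] at pullback_apply
  refine (rePart_knotCrossRatio_apply (hγ.differentiable one_ne_zero) hp w).trans
    (Eq.trans ?_ (congrArg (-(1 / 2) * ·) pullback_apply).symm)
  ring

theorem exists_extDeriv_eq_rePart_knotCrossRatio {r : ℕ∞} (hr : 1 ≤ r)
    (hγ : ContDiff ℝ (r + 1) fun t => (γ t : Euc 4)) (hper : Function.Periodic γ 1) :
    ∃ η : ℝ × ℝ → (ℝ × ℝ) [⋀^Fin 1]→L[ℝ] ℝ,
      ContDiffOn ℝ r η (knotPairs γ) ∧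
      (∀ (p : ℝ × ℝ) (k l : ℤ), η (p.1 + k, p.2 + l) = η p) ∧
      ∀ p ∈ knotPairs γ, extDeriv η p = rePart (knotCrossRatio γ p) := by
  obtain ⟨coe_diff, -, deriv_contDiff⟩ := contDiff_succ_iff_deriv.1 hγ
  have coe_contDiff : ContDiff ℝ r fun t => (γ t : Euc 4) := hγ.of_le le_self_add
  have denominator_ne_zero {p : ℝ × ℝ} (hp : p ∈ knotPairs γ) := (one_sub_inner_pos hp).ne'
  refine ⟨knotPrimitive fun t => (γ t : Euc 4), fun p hp => ?_, fun p k l => ?_, fun p hp => ?_⟩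
  · exact (contDiffAt_knotPrimitive coe_contDiff deriv_contDiff
      (denominator_ne_zero hp)).contDiffWithinAt
  · exact knotPrimitive_add_intCast (hper.comp Subtype.val) p k l
  · ext w
    have potential_diff := (contDiffAt_knotPotential coe_contDiff deriv_contDiff
      (denominator_ne_zero hp)).differentiableAt (by exact_mod_cast (one_pos.trans_le hr).ne')
    rw [extDeriv_knotPrimitive coe_diff (denominator_ne_zero hp) potential_diff,
      rePart_knotCrossRatio_apply coe_diff hp]

end Knot

end MoebiusKnot

theorem mainTheorem2_general :
    (∀ n : ℕ,
      BijOn (toCotangent n) (distinctPairs (Sph n)) univ ∧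
      ContMDiffOn (pairModel n) (cotangentModel n) ∞ (toCotangent n) (distinctPairs (Sph n)) ∧
      ∀ T : Sph n → Sph n, IsMoebius T →
        ContMDiff (𝓡 n) (𝓡 n) ∞ T ∧
        MapsTo (Prod.map T T) (distinctPairs (Sph n)) (distinctPairs (Sph n)) ∧
        ∀ p ∈ distinctPairs (Sph n),
          pullback (pairModel n) (pairModel n) (Prod.map T T) (omegaSphere n) p
            = omegaSphere n p) ∧
    (∀ σ : ℂ → Sph 2, IsInvStereo σ → ∀ p ∈ distinctPairs ℂ,
      rePart (crossRatioForm p)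
        = (-(1 / 2) : ℝ) • pullback 𝓘(ℝ, ℂ × ℂ) (pairModel 2) (Prod.map σ σ) (omegaSphere 2) p) ∧
    (∀ (r : ℕ∞) (γ : ℝ → Sph 3), 1 ≤ r →
      ContDiff ℝ (r + 1) (fun t => (γ t : Euc 4)) → Function.Periodic γ 1 →
      (∀ p ∈ knotPairs γ, ∃! c : ℂ, IsKnotCrossRatio γ p c) ∧
      (∀ p ∈ knotPairs γ,
        rePart (knotCrossRatio γ p)
          = (-(1 / 2) : ℝ) •
            pullback 𝓘(ℝ, ℝ × ℝ) (pairModel 3) (Prod.map γ γ) (omegaSphere 3) p) ∧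
      ∃ η : ℝ × ℝ → (ℝ × ℝ) [⋀^Fin 1]→L[ℝ] ℝ,
        ContDiffOn ℝ r η (knotPairs γ) ∧
        (∀ (p : ℝ × ℝ) (k l : ℤ), η (p.1 + k, p.2 + l) = η p) ∧
        ∀ p ∈ knotPairs γ, extDeriv η p = rePart (knotCrossRatio γ p)) := by
  refine ⟨fun n => ⟨bijOn_toCotangent n,
    fun p hp => (contMDiffAt_toCotangent hp).contMDiffWithinAt, fun T hT => ?_⟩,
    fun σ hσ p hp => rePart_crossRatioForm hσ hp, fun r γ hr hγ hper => ?_⟩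
  · obtain ⟨M, hM⟩ := hT.exists_isLorentzLift
    exact ⟨hM.contMDiff, fun p hp => hM.apply_ne_apply hp, fun p hp => hM.pullback_omegaSphere hp⟩
  · have contDiff_one : ContDiff ℝ 1 fun t => (γ t : Euc 4) := hγ.of_le le_add_self
    exact ⟨fun p hp => existsUnique_isKnotCrossRatio (contDiff_one.differentiable one_ne_zero) hp,
      fun p hp => rePart_knotCrossRatio contDiff_one hp,
      exists_extDeriv_eq_rePart_knotCrossRatio hr hγ hper⟩

theorem mainTheorem2 :
    -- `φ` is a smooth bijection from `S^n × S^n ∖ Δ` onto `T^* S^n`, and `ω_{S^n}` is invariant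
    (∀ n : ℕ,
      BijOn (toCotangent n) (distinctPairs (Sph n)) univ ∧
      ContMDiffOn (pairModel n) (cotangentModel n) ∞ (toCotangent n) (distinctPairs (Sph n)) ∧
      ∀ T : Sph n → Sph n, IsMoebius T →
        ContMDiff (𝓡 n) (𝓡 n) ∞ T ∧ MapsTo (Prod.map T T) (distinctPairs (Sph n)) (distinctPairs (Sph n)) ∧
        ∀ p ∈ distinctPairs (Sph n),
          pullback (pairModel n) (pairModel n) (Prod.map T T) (omegaSphere n) p
            = omegaSphere n p) ∧
    -- `Re ω_cr = -½ ω_{S^2}`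
    (∀ σ : ℂ → Sph 2, IsInvStereo σ → ∀ p ∈ distinctPairs ℂ,
      rePart (crossRatioForm p)
        = (-(1 / 2) : ℝ) • pullback 𝓘(ℝ, ℂ × ℂ) (pairModel 2) (Prod.map σ σ) (omegaSphere 2) p) ∧
    -- `Re Ω_K = -½ ι^* ω_{S^3}`, and `Re Ω_K` is exact
    (∀ (r : ℕ∞) (γ : ℝ → Sph 3), 1 ≤ r → IsKnot (r + 1 : ℕ∞) γ →
      (∀ p ∈ knotPairs γ, ∃! c : ℂ, IsKnotCrossRatio γ p c) ∧
      (∀ p ∈ knotPairs γ,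
        rePart (knotCrossRatio γ p)
          = (-(1 / 2) : ℝ) •
            pullback 𝓘(ℝ, ℝ × ℝ) (pairModel 3) (Prod.map γ γ) (omegaSphere 3) p) ∧
      ∃ η : ℝ × ℝ → (ℝ × ℝ) [⋀^Fin 1]→L[ℝ] ℝ,
        ContDiffOn ℝ r η (knotPairs γ) ∧
        (∀ (p : ℝ × ℝ) (k l : ℤ), η (p.1 + k, p.2 + l) = η p) ∧
        ∀ p ∈ knotPairs γ, extDeriv η p = rePart (knotCrossRatio γ p)) := by
  refine ⟨mainTheorem2_general.1, mainTheorem2_general.2.1, fun r γ hr hγ => ?_⟩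
  exact mainTheorem2_general.2.2 r γ hr hγ.contDiff
    fun t => ((hγ.eq_iff t (t + 1)).2 ⟨1, by simp⟩).symm
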